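/- Let $N\ge 2$, let $e_{k,l}$ be the matrix units, $\mathbf h\subset sl_N$ the traceless diagonal matrices, $(x,y)=\operatorname{tr}(xy)$ (used to identify $\mathbf h^*$ with $\mathbf h$), $\alpha_{k,l}=e_{k,k}-e_{l,l}$ for $k<l$ the positive roots, $\alpha_k=\alpha_{k,k+1}$, and $\rho=\frac12\sum_{k<l}\alpha_{k,l}$. For $j=1,\dots,p$ let $V_j$ be a highest weight $sl_N$-module with highest weight $\Lambda_j\in\mathbf h$ and generating highest weight vector $v_j$. Fix $m_1,\dots,m_{N-1}\in\mathbb Z_{\ge0}$, put $\nu_0=\sum_k m_k\alpha_k$ and $\nu=\sum_{j=1}^{p}\Lambda_j-\nu_0$, and let $\kappa\in\mathbb C\setminus\{0\}$. Let $t=(t_k^{(d)})$, $1\le k\le N-1$, $1\le d\le m_k$, be coordinates on $\mathbb C^m$, $m=\sum_k m_k$, ordered lexicographically by $(k,d)$, and let $dt$ be the product of the $dt_k^{(d)}$ in this order. **Orders and PBW bases.** The standard order is $\alpha_{k,l}\succ\alpha_{k',l'}$ iff $l>l'$, or $l=l'$ and $k>k'$. For $1\le h\le N-1$ let $A_h=\{\alpha_{k,l}:k\le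 h<l\}$, $B_h=\{\alpha_{k,l}:l\le h\}$, $C_h=\{\alpha_{k,l}:h<k\}$. The order $\succ_h$ puts $A_h\succ_h B_h\succ_h C_h$; within $A_h$, $\alpha_{k,l}\succ_h\alpha_{k',l'}$ iff $l<l'$, or $l=l'$ and $k>k'$; within $B_h$ it is the standard order; within $C_h$, $\alpha_{k,l}\succ_h\alpha_{k',l'}$ iff $k<k'$, or $k=k'$ and $l<l'$. Let $a_{k,l}(h)$ be the number of integers $q$ with $k<q<l$ and $\alpha_{k,q}\succ_h\alpha_{q,l}$, and $F_{k,l}(h)=(-1)^{a_{k,l}(h)}e_{l,k}$. For a family $I_0=(i_{l,k})_{k<l}$ of non-negative integers put in $U(\mathbf n_-)$ $$F_{I_0}=(-1)^{\sum i_{l,k}}\prod_{k<l}\frac{e_{l,k}^{\,i_{l,k}}}{i_{l,k}!},\qquad F_{I_0}(h)=(-1)^{\sum i_{l,k}}\prod_{k<l}\frac{F_{k,l}(h)^{i_{l,k}}}{i_{l,k}!},$$ the factors being written from left to right in decreasing order with respect to $\succ$, respectively $\succ_h$. Let $P(\nu_0,p)$ be the set of $I=(I_1,\dots,I_p)$,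 $I_j=(i^j_{l,k})_{k<l}$, with $\sum_j\sum_{k\le h<l}i^j_{l,k}=m_h$ for all $h$, and $F_Iv=F_{I_1}v_1\otimes\cdots\otimes F_{I_p}v_p$, $F_I(h)v=F_{I_1}(h)v_1\otimes\cdots\otimes F_{I_p}(h)v_p$. **Rational functions.** For $I\in P(\nu_0,p)$ let $S(I)$ be the set of $s=(j,k,l,q)$ with $1\le j\le p$, $1\le k<l\le N$, $1\le q\le i^j_{l,k}$, and $S_h(I)$ the set of those with $k\le h<l$. Fix bijections $\beta_h(I):S_h(I)\to\{1,\dots,m_h\}$ for all $I$ and $h$, write $t_{h,s}=t_h^{(\beta_h(I)(s))}$, and let $f^{(s)}=\prod_{h'=k}^{l-2}(t_{h',s}-t_{h'+1,s})^{-1}$. Set $\phi(I)=\prod_{s\in S(I)}f^{(s)}\,(t_{l-1,s}-z_j)^{-1}$ and $\phi(I,h)=\prod_{s\in S(I)}\phi^{(s)}_h$, where $$\phi_h^{(s)}=\begin{cases}f^{(s)}(-1)^{l-1-h}(t_{h,s}-z_j)^{-1},&k\le h<l,\\ f^{(s)}(t_{l-1,s}-z_j)^{-1},&l\le h,\\ f^{(s)}(-1)^{l-1-k}(t_{k,s}-z_j)^{-1},&h<k.\end{cases}$$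 **Master functions and cycles.** Put $$\Phi'(z,t)=\prod_{i<j}(z_i-z_j)^{(\Lambda_i,\Lambda_j)}\prod_{(k,d),j}(t_k^{(d)}-z_j)^{-(\alpha_k,\Lambda_j)}\prod_{(k,d)<(l,d')}(t_k^{(d)}-t_l^{(d')})^{(\alpha_k,\alpha_l)},$$ $$\Phi(z,t;\lambda)=\Phi'(z,t)\prod_{(k,d)}(t_k^{(d)})^{-(\alpha_k,\lambda-\rho-\nu/2)}\prod_i z_i^{(\Lambda_i,\lambda-\nu/2+\Lambda_i/2)}\qquad(\lambda\in\mathbf h).$$ For a finite tuple $w$ of complex numbers let $\mathcal D(w)\subset\mathbb C^m$ be the union of the hyperplanes $t_k^{(d)}=w_j$ and $t_k^{(d)}=t_{k+1}^{(d')}$, and let $X(w)$ be the complement of $\mathcal D(w)$ and of the hyperplanes $t_k^{(d)}=t_k^{(d')}$, $d\ne d'$. A twisted cycle for $\Phi'^{1/\kappa}$ at $z$ is an $m$-dimensional cycle of smooth singular chains in $X(z)$ with coefficients in the local system of constant multiples of branches of $\Phi'(z,\cdot)^{1/\kappa}$; a twisted cycle for $\Phi(\cdot;\lambda)^{1/\kappa}$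 at $z$ is defined likewise in $X(z,0)$. Matsuo's assumption on a twisted cycle $\gamma$ is that $\int_\gamma\Phi'^{1/\kappa}\varphi(t)\,dt=\int_\gamma\Phi'^{1/\kappa}\varphi(\sigma t)\,dt$ (respectively with $\Phi$) for every rational function $\varphi$ of $t$ with poles in $\mathcal D(z)$ (respectively $\mathcal D(z,0)$) and every $\sigma\in\Sigma_{m_1}\times\cdots\times\Sigma_{m_{N-1}}$ permuting the coordinates $t_k^{(d)}$ with the same $k$; the branch is the one carried by $\gamma$ on both sides, as $\Phi'$ and $\Phi$ are invariant under $\sigma$. **Statement.** (a) Let $\gamma(z)$ be a family of twisted cycles for $\Phi'^{1/\kappa}$, satisfying Matsuo's assumption, over a set of points $z\in\mathbb C^p$ with distinct coordinates (for example a horizontal family), and let $u(z)=\int_{\gamma(z)}\Phi'(z,t)^{1/\kappa}\sum_{I\in P(\nu_0,p)}\phi(I)F_Iv\,dt$ (for a horizontal family this is the hypergeometric solution of the rational KZ equations with values in $V_1\otimes\cdots\otimes V_p$). Then for every $h=1,\dots,N-1$ $$u(z)=\int_{\gamma(z)}\Phi'(z,t)^{1/\kappa}\Big(\sum_{I\in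 P(\nu_0,p)}\phi(I,h)F_I(h)v\Big)dt .$$ (b) Let $\lambda\in\mathbf h$, let $\gamma(z)$ be a family of twisted cycles for $\Phi(\cdot;\lambda)^{1/\kappa}$, satisfying Matsuo's assumption, over a set of points $z\in\mathbb C^p$ with distinct non-zero coordinates (for example a horizontal family), and let $v(z,\lambda)=\int_{\gamma(z)}\Phi(z,t;\lambda)^{1/\kappa}\sum_{I\in P(\nu_0,p)}\phi(I)F_Iv\,dt$ (for a horizontal family this is the hypergeometric solution of the trigonometric KZ equations). For $h=1,\dots,N-1$ put $$v(z,\lambda;h)=\int_{\gamma(z)}\Phi(z,t;\lambda)^{1/\kappa}\Big(\sum_{I\in P(\nu_0,p)}\phi(I,h)F_I(h)v\Big)dt .$$ Then $v(z,\lambda)=v(z,\lambda;h)$. In both parts all the integrals exist. -/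

import Mathlib

open scoped BigOperators TensorProduct

attribute [local instance] LieRing.ofAssociativeRing

noncomputable section

namespace KZ

/-! ## The Lie algebra `sl_N`, `N = r + 1`

Matrix indices `1, …, N` are the elements of `Fin (r + 1)`, and the simple roots
`α_k = e_{k,k} - e_{k+1,k+1}` are indexed by `Fin r` (all indices are shifted down by one). -/

/-- The Lie algebra `sl_{r+1}` over `ℂ`. -/
abbrev SL (r : ℕ) : LieSubalgebra ℂ (Matrix (Fin (r + 1)) (Fin (r + 1)) ℂ) :=
  LieAlgebra.SpecialLinear.sl (Fin (r + 1)) ℂ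

/-- The Cartan subalgebra `h = {∑ λ_k e_{k,k} | ∑ λ_k = 0}`, identified with its dual by the
trace form. -/
def Cartan (r : ℕ) : Submodule ℂ (Fin (r + 1) → ℂ) where
  carrier := {x | ∑ i, x i = 0}
  add_mem' := by
    intro a b ha hb
    simp only [Set.mem_ofPred_eq, Pi.add_apply, Finset.sum_add_distrib] at *
    rw [ha, hb, add_zero]
  zero_mem' := by simp
  smul_mem' := by
    intro c a ha
    simp only [Set.mem_ofPred_eq, Pi.smul_apply, smul_eq_mul, ← Finset.mul_sum] at *
    rw [ha, mul_zero]

/-- The scalar product on `h`: `(e_{k,k}, e_{l,l}) = δ_{k,l}`. -/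
def pair {r : ℕ} (x y : Cartan r) : ℂ := ∑ i, (x : Fin (r + 1) → ℂ) i * (y : Fin (r + 1) → ℂ) i

/-- An element of `h` as a diagonal matrix in `sl_N`. -/
def diag {r : ℕ} (x : Cartan r) : SL r :=
  ⟨Matrix.diagonal (x : Fin (r + 1) → ℂ),
    LinearMap.mem_ker.2 ((Matrix.trace_diagonal _).trans x.2)⟩

/-- The element `α_{k,l} = e_{k,k} - e_{l,l}` of `h`. -/
def rootVec {r : ℕ} (k l : Fin (r + 1)) : Cartan r :=
  ⟨Pi.single k 1 - Pi.single l 1, by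
    change ∑ i, (Pi.single k (1 : ℂ) - Pi.single l (1 : ℂ) : Fin (r + 1) → ℂ) i = 0
    simp [Finset.sum_sub_distrib]⟩

/-- The simple root `α_k`. -/
def simpleRoot {r : ℕ} (k : Fin r) : Cartan r := rootVec k.castSucc k.succ

/-- The positive roots `α_{k,l}`, `k < l`, as pairs `(k, l)`. -/
abbrev PosRoot (r : ℕ) : Type := {a : Fin (r + 1) × Fin (r + 1) // a.1 < a.2}

/-- Half the sum of the positive roots. -/
def rho (r : ℕ) : Cartan r := (2⁻¹ : ℂ) • ∑ a : PosRoot r, rootVec a.1.1 a.1.2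

/-- The matrix unit `e_{l,k}` attached to the positive root `α_{k,l}`. -/
def lowering {r : ℕ} (a : PosRoot r) : SL r :=
  LieAlgebra.SpecialLinear.single a.1.2 a.1.1 (ne_of_gt a.2) 1

/-- The matrix unit `e_{k,l}` attached to the positive root `α_{k,l}`. -/
def raising {r : ℕ} (a : PosRoot r) : SL r :=
  LieAlgebra.SpecialLinear.single a.1.1 a.1.2 (ne_of_lt a.2) 1

/-- `W` is a highest weight module with highest weight `Λ` and highest weight vector `v`: the
vector `v` is killed by `n_+`, has weight `Λ`, and generates `W`. -/
structure IsHighestWeight {r : ℕ} {W : Type*} [AddCommGroup W] [Module ℂ W]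
    [LieRingModule (SL r) W] [LieModule ℂ (SL r) W] (Λ : Cartan r) (v : W) : Prop where
  ne_zero : v ≠ 0
  raising_eq_zero : ∀ a : PosRoot r, ⁅raising a, v⁆ = 0
  weight : ∀ x : Cartan r, ⁅diag x, v⁆ = pair x Λ • v
  generates : LieSubmodule.lieSpan ℂ (SL r) {v} = ⊤

/-! ## Orders on the positive roots and PBW bases of `U(n_-)` -/

/-- The standard order: `StdSucc a b` says `a ≻ b`. -/
def StdSucc {r : ℕ} (a b : PosRoot r) : Prop :=
  b.1.2 < a.1.2 ∨ (a.1.2 = b.1.2 ∧ b.1.1 < a.1.1)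

/-- The set `A_h` of the roots `α_{k,l}` with `k ≤ h < l`. -/
def InA {r : ℕ} (h : Fin r) (a : PosRoot r) : Prop := a.1.1 ≤ h.castSucc ∧ h.castSucc < a.1.2

/-- The set `B_h` of the roots `α_{k,l}` with `l ≤ h`. -/
def InB {r : ℕ} (h : Fin r) (a : PosRoot r) : Prop := a.1.2 ≤ h.castSucc

/-- The set `C_h` of the roots `α_{k,l}` with `h < k`. -/
def InC {r : ℕ} (h : Fin r) (a : PosRoot r) : Prop := h.castSucc < a.1.1

/-- The special order `≻_h`: `Succ h a b` says `a ≻_h b`. -/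
def Succ {r : ℕ} (h : Fin r) (a b : PosRoot r) : Prop :=
  (InA h a ∧ InB h b) ∨ (InA h a ∧ InC h b) ∨ (InB h a ∧ InC h b) ∨
  (InA h a ∧ InA h b ∧ (a.1.2 < b.1.2 ∨ (a.1.2 = b.1.2 ∧ b.1.1 < a.1.1))) ∨
  (InB h a ∧ InB h b ∧ StdSucc a b) ∨
  (InC h a ∧ InC h b ∧ (a.1.1 < b.1.1 ∨ (a.1.1 = b.1.1 ∧ a.1.2 < b.1.2)))

/-- The defining properties of a strict linear order. -/
structure IsLinear {r : ℕ} (R : PosRoot r → PosRoot r → Prop) : Prop where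
  irrefl : ∀ a, ¬ R a a
  trans : ∀ a b c, R a b → R b c → R a c
  total : ∀ a b, a ≠ b → R a b ∨ R b a

theorem stdSucc_isLinear (r : ℕ) : IsLinear (StdSucc (r := r)) where
  irrefl := by
    intro a
    unfold StdSucc
    omega
  trans := by
    intro a b c
    unfold StdSucc
    omega
  total := by
    rintro ⟨⟨a, a'⟩, ha⟩ ⟨⟨b, b'⟩, hb⟩ hab
    simp only [ne_eq, Subtype.mk.injEq, Prod.mk.injEq] at hab
    simp only [StdSucc]
    omega

theorem mem_blocks {r : ℕ} (h : Fin r) (a : PosRoot r) :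
    (InA h a ∧ ¬ InB h a ∧ ¬ InC h a) ∨ (¬ InA h a ∧ InB h a ∧ ¬ InC h a) ∨
      (¬ InA h a ∧ ¬ InB h a ∧ InC h a) := by
  have ha := a.2
  unfold InA InB InC
  omega

theorem succ_isLinear {r : ℕ} (h : Fin r) : IsLinear (Succ h) where
  irrefl := by
    intro a
    rcases mem_blocks h a with ⟨h1, h2, h3⟩ | ⟨h1, h2, h3⟩ | ⟨h1, h2, h3⟩ <;>
      simp [Succ, StdSucc, h1, h2, h3]
  trans := by
    intro a b c
    rcases mem_blocks h a with ⟨h1, h2, h3⟩ | ⟨h1, h2, h3⟩ | ⟨h1, h2, h3⟩ <;>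
      rcases mem_blocks h b with ⟨k1, k2, k3⟩ | ⟨k1, k2, k3⟩ | ⟨k1, k2, k3⟩ <;>
      rcases mem_blocks h c with ⟨l1, l2, l3⟩ | ⟨l1, l2, l3⟩ | ⟨l1, l2, l3⟩ <;>
      simp only [Succ, StdSucc, h1, h2, h3, k1, k2, k3, l1, l2, l3, true_and, false_and,
        or_false, false_or, or_true, and_false, and_true, implies_true,
        false_imp_iff, true_imp_iff] <;>
      omega
  total := by
    intro a b hab
    have hab' : ¬ (a.1.1 = b.1.1 ∧ a.1.2 = b.1.2) := fun e => hab (Subtype.ext (Prod.ext e.1 e.2))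
    rcases mem_blocks h a with ⟨h1, h2, h3⟩ | ⟨h1, h2, h3⟩ | ⟨h1, h2, h3⟩ <;>
      rcases mem_blocks h b with ⟨k1, k2, k3⟩ | ⟨k1, k2, k3⟩ | ⟨k1, k2, k3⟩ <;>
      simp only [Succ, StdSucc, h1, h2, h3, k1, k2, k3, true_and, false_and,
        or_false, false_or, or_true, and_false, and_true] <;>
      omega

open Classical in
/-- All positive roots, listed from the largest to the smallest one for the linear order `R`. -/
def sortedRoots {r : ℕ} (R : PosRoot r → PosRoot r → Prop) (hR : IsLinear R) :
    List (PosRoot r) :=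
  letI : IsTrans (PosRoot r) (fun a b => a = b ∨ R a b) := ⟨by
    rintro a b c (rfl | hab) (rfl | hbc)
    · exact Or.inl rfl
    · exact Or.inr hbc
    · exact Or.inr hab
    · exact Or.inr (hR.trans _ _ _ hab hbc)⟩
  letI : Std.Antisymm (fun a b : PosRoot r => a = b ∨ R a b) := ⟨by
    rintro a b (rfl | hab) (hba | hba)
    · rfl
    · rfl
    · exact hba.symm
    · exact absurd (hR.trans _ _ _ hab hba) (hR.irrefl a)⟩
  letI : Std.Total (fun a b : PosRoot r => a = b ∨ R a b) := ⟨by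
    intro a b
    by_cases hab : a = b
    · exact Or.inl (Or.inl hab)
    · exact (hR.total a b hab).imp Or.inr Or.inr⟩
  (Finset.univ : Finset (PosRoot r)).sort (fun a b => a = b ∨ R a b)

/-- The PBW monomial `(-1)^{∑ i_a} ∏_a F_a^{i_a} / i_a!`, the factors being written from left to
right in decreasing order. -/
def pbwMonomial {r : ℕ} (R : PosRoot r → PosRoot r → Prop) (hR : IsLinear R)
    (F : PosRoot r → SL r) (i : PosRoot r → ℕ) : UniversalEnvelopingAlgebra ℂ (SL r) :=
  ((-1 : ℂ) ^ (∑ a, i a)) •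
    ((sortedRoots R hR).map fun a =>
      ((Nat.factorial (i a) : ℂ)⁻¹) • UniversalEnvelopingAlgebra.ι ℂ (F a) ^ i a).prod

/-- The standard PBW basis element `F_{I_0}`. -/
def stdF {r : ℕ} (i : PosRoot r → ℕ) : UniversalEnvelopingAlgebra ℂ (SL r) :=
  pbwMonomial StdSucc (stdSucc_isLinear r) lowering i

open Classical in
/-- The number `a_{k,l}(h)` of the integers `p` with `k < p < l` and `α_{k,p} ≻_h α_{p,l}`. -/
def reversals {r : ℕ} (h : Fin r) (a : PosRoot r) : ℕ :=
  (Finset.univ.filter fun p : Fin (r + 1) =>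
    ∃ (h₁ : a.1.1 < p) (h₂ : p < a.1.2), Succ h ⟨(a.1.1, p), h₁⟩ ⟨(p, a.1.2), h₂⟩).card

/-- The root vector `F_{k,l}(h) = (-1)^{a_{k,l}(h)} e_{l,k}`. -/
def rootF {r : ℕ} (h : Fin r) (a : PosRoot r) : SL r := ((-1 : ℂ) ^ reversals h a) • lowering a

/-- The element `F_{I_0}(h)` of the PBW basis corresponding to `≻_h`. -/
def specialF {r : ℕ} (h : Fin r) (i : PosRoot r → ℕ) : UniversalEnvelopingAlgebra ℂ (SL r) :=
  pbwMonomial (Succ h) (succ_isLinear h) (rootF h) i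

/-- The action of the universal enveloping algebra on a module. -/
def act {r : ℕ} {W : Type*} [AddCommGroup W] [Module ℂ W] [LieRingModule (SL r) W]
    [LieModule ℂ (SL r) W] (x : UniversalEnvelopingAlgebra ℂ (SL r)) (w : W) : W :=
  UniversalEnvelopingAlgebra.lift ℂ (LieModule.toEnd ℂ (SL r) W) x w

/-! ## The index sets -/

/-- The finite set `P(ν_0, p)`, `ν_0 = ∑ m_k α_k`, of all families `I = (I_1, …, I_p)` of
exponents with `∑_j ∑_{k ≤ h < l} i^j_{l,k} = m_h` for all `h` (see `mem_indexSet`). -/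
def indexSet {r : ℕ} (m : Fin r → ℕ) (p : ℕ) : Finset (Fin p → PosRoot r → ℕ) :=
  (Fintype.piFinset fun _ => Fintype.piFinset fun _ => Finset.range (∑ h, m h + 1)).filter
    fun I => ∀ h : Fin r,
      (∑ j, ∑ a : PosRoot r, if a.1.1 ≤ h.castSucc ∧ h.castSucc < a.1.2 then I j a else 0) = m h

theorem mem_indexSet {r : ℕ} (m : Fin r → ℕ) (p : ℕ) (I : Fin p → PosRoot r → ℕ) :
    I ∈ indexSet m p ↔ ∀ h : Fin r,
      (∑ j, ∑ a : PosRoot r, if a.1.1 ≤ h.castSucc ∧ h.castSucc < a.1.2 then I j a else 0)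
        = m h := by
  unfold indexSet
  rw [Finset.mem_filter, and_iff_right_iff_imp]
  intro H
  simp only [Fintype.mem_piFinset, Finset.mem_range, Nat.lt_succ_iff]
  intro j a
  have hk : (a.1.1 : ℕ) < r := by
    have h1 := a.2
    have h2 := a.1.2.isLt
    omega
  let h : Fin r := ⟨a.1.1, hk⟩
  have h1 : I j a ≤ m h := by
    rw [← H h]
    refine le_trans ?_ (Finset.single_le_sum (fun _ _ => Nat.zero_le _) (Finset.mem_univ j))
    refine le_trans ?_ (Finset.single_le_sum (fun _ _ => Nat.zero_le _) (Finset.mem_univ a))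
    have e : h.castSucc = a.1.1 := rfl
    rw [if_pos ⟨e.ge, e ▸ a.2⟩]
  exact h1.trans (Finset.single_le_sum (f := m) (fun _ _ => Nat.zero_le _) (Finset.mem_univ h))

/-- The set `S(I)` of the quadruples `(j, k, l, q)` with `1 ≤ q ≤ i^j_{l,k}`. -/
abbrev Slots {r p : ℕ} (I : Fin p → PosRoot r → ℕ) : Type :=
  Σ j : Fin p, Σ a : PosRoot r, Fin (I j a)

/-- The set `S_h(I)` of the quadruples `(j, k, l, q)` in `S(I)` with `k ≤ h < l`. -/
abbrev SlotsAt {r p : ℕ} (I : Fin p → PosRoot r → ℕ) (h : Fin r) : Type :=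
  {s : Slots I // (s.2.1.1.1 : ℕ) ≤ h ∧ (h : ℕ) < s.2.1.1.2}

/-- A choice of bijections `β_h(I) : S_h(I) → {1, …, m_h}` for all `I` and `h`. -/
abbrev Bijections {r : ℕ} (m : Fin r → ℕ) (p : ℕ) : Type :=
  ∀ (I : indexSet m p) (h : Fin r), SlotsAt I.1 h ≃ Fin (m h)

/-! ## The rational functions -/

/-- The index set of the coordinates `t_k^{(d)}`, `1 ≤ d ≤ m_k`. -/
abbrev Coord {r : ℕ} (m : Fin r → ℕ) : Type := Σ k : Fin r, Fin (m k)

section Rational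

variable {r p : ℕ} {m : Fin r → ℕ} (β : Bijections m p) (I : indexSet m p)

/-- The variable `t_h^{(β_h(I)(s))}` for `s = (j, k, l, q)` and `k ≤ h < l` (and `0` for other
`h`, which never occur below). -/
def slotVar (t : Coord m → ℂ) (s : Slots I.1) (h : ℕ) : ℂ :=
  if hs : (s.2.1.1.1 : ℕ) ≤ h ∧ h < s.2.1.1.2 then
    t ⟨⟨h, by have := s.2.1.1.2.isLt; omega⟩, β I ⟨h, by have := s.2.1.1.2.isLt; omega⟩ ⟨s, hs⟩⟩
  else 0

/-- The function `f^{(s)} = ∏_{h = k}^{l - 2} 1 / (t_h - t_{h+1})`. -/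
def slotChain (t : Coord m → ℂ) (s : Slots I.1) : ℂ :=
  ∏ h ∈ Finset.Ico (s.2.1.1.1 : ℕ) (s.2.1.1.2 - 1),
    1 / (slotVar β I t s h - slotVar β I t s (h + 1))

/-- The function `φ^{(s)} = f^{(s)} / (t_{l-1} - z_j)`. -/
def slotPhi (z : Fin p → ℂ) (t : Coord m → ℂ) (s : Slots I.1) : ℂ :=
  slotChain β I t s * (1 / (slotVar β I t s (s.2.1.1.2 - 1) - z s.1))

/-- The function `φ^{(s)}_h`. -/
def slotPhiAt (h : Fin r) (z : Fin p → ℂ) (t : Coord m → ℂ) (s : Slots I.1) : ℂ :=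
  if (s.2.1.1.1 : ℕ) ≤ h ∧ (h : ℕ) < s.2.1.1.2 then
    slotChain β I t s * ((-1) ^ ((s.2.1.1.2 : ℕ) - 1 - h) / (slotVar β I t s h - z s.1))
  else if (s.2.1.1.2 : ℕ) ≤ h then
    slotChain β I t s * (1 / (slotVar β I t s (s.2.1.1.2 - 1) - z s.1))
  else
    slotChain β I t s *
      ((-1) ^ ((s.2.1.1.2 : ℕ) - 1 - s.2.1.1.1) / (slotVar β I t s s.2.1.1.1 - z s.1))

/-- The rational function `φ(I)`. -/
def phi (z : Fin p → ℂ) (t : Coord m → ℂ) : ℂ := ∏ s : Slots I.1, slotPhi β I z t s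

/-- The rational function `φ(I, h)`. -/
def phiAt (h : Fin r) (z : Fin p → ℂ) (t : Coord m → ℂ) : ℂ :=
  ∏ s : Slots I.1, slotPhiAt β I h z t s

end Rational

section Vectors

variable {r p : ℕ} {m : Fin r → ℕ} {V : Fin p → Type*} [∀ j, AddCommGroup (V j)]
  [∀ j, Module ℂ (V j)] [∀ j, LieRingModule (SL r) (V j)] [∀ j, LieModule ℂ (SL r) (V j)]

/-- The vector-valued rational function `∑_I φ(I) F_I v`, where
`F_I v = F_{I_1} v_1 ⊗ ⋯ ⊗ F_{I_p} v_p`. -/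
def stdForm (v : ∀ j, V j) (β : Bijections m p) (z : Fin p → ℂ) (t : Coord m → ℂ) :
    PiTensorProduct ℂ V :=
  ∑ I : indexSet m p, phi β I z t • PiTensorProduct.tprod ℂ fun j => act (stdF (I.1 j)) (v j)

/-- The vector-valued rational function `∑_I φ(I, h) F_I(h) v`, where
`F_I(h) v = F_{I_1}(h) v_1 ⊗ ⋯ ⊗ F_{I_p}(h) v_p`. -/
def specialForm (v : ∀ j, V j) (β : Bijections m p) (h : Fin r) (z : Fin p → ℂ)
    (t : Coord m → ℂ) : PiTensorProduct ℂ V :=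
  ∑ I : indexSet m p,
    phiAt β I h z t • PiTensorProduct.tprod ℂ fun j => act (specialF h (I.1 j)) (v j)

end Vectors

/-! ## Twisted cycles

A multivalued function on `ℂ^m` is given as a formal product `∏_f g_f(t)^{a_f}` with single-valued
`g_f` and complex exponents `a_f`. A twisted chain assigns to finitely many smooth singular
simplices `τ` a branch along `τ` of (a constant multiple of) `(∏_f g_f^{a_f})^{1/κ}`. -/

/-- The standard simplex of dimension `d`, in barycentric coordinates `x_0, …, x_d`. -/
abbrev Simplex (d : ℕ) : Type := stdSimplex ℝ (Fin (d + 1))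

/-- Singular chains of dimension `d` in `E` whose coefficient at a singular simplex `τ` is a
complex function on the standard simplex (a section over `τ`). -/
abbrev Chain (d : ℕ) (E : Type*) : Type _ := (Simplex d → E) →₀ (Simplex d → ℂ)

/-- The `j`-th face inclusion of the standard simplex. -/
def faceMap {d : ℕ} (j : Fin (d + 2)) : Simplex d → Simplex (d + 1) := stdSimplex.map j.succAbove

/-- The boundary of a chain, restricting both the simplices and the sections to the faces. -/
def boundary {d : ℕ} {E : Type*} (c : Chain (d + 1) E) : Chain d E :=
  c.sum fun τ s => ∑ j : Fin (d + 2),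
    Finsupp.single (τ ∘ faceMap j) (((-1 : ℂ) ^ (j : ℕ)) • (s ∘ faceMap j))

/-- Chains with zero boundary. -/
def IsClosedChain {E : Type*} : {d : ℕ} → Chain d E → Prop
  | 0, _ => True
  | _ + 1, c => boundary c = 0

/-- A singular simplex is smooth if it is the restriction of a smooth map. -/
def IsSmoothSimplex {d : ℕ} {T : Type*} [Fintype T] (τ : Simplex d → T → ℂ) : Prop :=
  ∃ g : (Fin (d + 1) → ℝ) → T → ℂ, ContDiff ℝ (⊤ : ℕ∞) g ∧ ∀ x : Simplex d, g x.1 = τ x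

/-- `s` is a constant multiple of a branch of `∏_f g_f^{a_f / κ}` along `τ`. -/
def IsBranchAlong {d : ℕ} {E ι : Type*} [Fintype ι] (g : ι → E → ℂ) (a : ι → ℂ) (κ : ℂ)
    (τ : Simplex d → E) (s : Simplex d → ℂ) : Prop :=
  ∃ L : ι → Simplex d → ℂ, (∀ f, Continuous (L f)) ∧
    (∀ f, a f ≠ 0 → ∀ x, Complex.exp (L f x) = g f (τ x)) ∧
    ∃ c : ℂ, ∀ x, s x = c * Complex.exp (κ⁻¹ * ∑ f, a f * L f x)

section Cycles

variable {r : ℕ} (m : Fin r → ℕ)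

/-- The complement in `ℂ^m` of the hyperplanes `t_k^{(d)} = w_j`, `t_k^{(d)} = t_{k+1}^{(d')}`
and `t_k^{(d)} = t_k^{(d')}`, `d ≠ d'`. -/
def complementSet {q : ℕ} (w : Fin q → ℂ) : Set (Coord m → ℂ) :=
  {t | (∀ a j, t a ≠ w j) ∧
    (∀ a b : Coord m, (a.1 : ℕ) + 1 = b.1 → t a ≠ t b) ∧
    (∀ a b : Coord m, a.1 = b.1 → a ≠ b → t a ≠ t b)}

/-- Cycles, of dimension equal to that of `ℂ^m`, of the twisted homology of the above complement
defined by the multivalued function `(∏_f g_f^{a_f})^{1/κ}`. -/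
structure TwistedCycle {q : ℕ} (w : Fin q → ℂ) {ι : Type*} [Fintype ι]
    (g : ι → (Coord m → ℂ) → ℂ) (a : ι → ℂ) (κ : ℂ) where
  chain : Chain (∑ k, m k) (Coord m → ℂ)
  smooth : ∀ τ ∈ chain.support, IsSmoothSimplex τ
  mem_complement : ∀ τ ∈ chain.support, ∀ x, τ x ∈ complementSet m w
  branch : ∀ τ ∈ chain.support, IsBranchAlong g a κ τ (chain τ)
  closed : IsClosedChain chain

variable {m}

/-- The standard simplex in the affine coordinates `x_1, …, x_d` (with `x_0 = 1 - ∑ x_i`). -/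
def corner (d : ℕ) : Set (Fin d → ℝ) :=
  {y | (Fin.cons (1 - ∑ i, y i) y : Fin (d + 1) → ℝ) ∈ stdSimplex ℝ (Fin (d + 1))}

open Classical in
/-- A function on the standard simplex written in the affine coordinates (zero outside). -/
def inCoords {d : ℕ} {E : Type*} [Zero E] (f : Simplex d → E) (y : Fin d → ℝ) : E :=
  if hy : (Fin.cons (1 - ∑ i, y i) y : Fin (d + 1) → ℝ) ∈ stdSimplex ℝ (Fin (d + 1)) then
    f ⟨_, hy⟩ else 0

/-- The Jacobian determinant of `τ`, so that `τ^* dt = jacobian τ dx_1 ∧ ⋯ ∧ dx_M`; here `dt` is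
the product of all `dt_k^{(d)}` in the lexicographic order of the pairs `(k, d)`. -/
def jacobian (τ : Simplex (∑ k, m k) → Coord m → ℂ) (y : Fin (∑ k, m k) → ℝ) : ℂ :=
  Matrix.det (Matrix.of fun a b : Fin (∑ k, m k) =>
    fderivWithin ℝ (inCoords τ) (corner _) y (Pi.single b 1) (finSigmaFinEquiv.symm a))

/-- The pull-back to the simplex `τ` of the form `s f dt`. -/
def pullback (τ : Simplex (∑ k, m k) → Coord m → ℂ) (s : Simplex (∑ k, m k) → ℂ)
    (f : (Coord m → ℂ) → ℂ) (y : Fin (∑ k, m k) → ℝ) : ℂ :=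
  inCoords s y * f (inCoords τ y) * jacobian τ y

/-- The integral of `(∏_f g_f^{a_f})^{1/κ} f dt` over a twisted chain, the branch of the
multivalued function being the section carried by the chain. -/
def chainIntegral (c : Chain (∑ k, m k) (Coord m → ℂ)) (f : (Coord m → ℂ) → ℂ) : ℂ :=
  c.sum fun τ s => ∫ y in corner (∑ k, m k), pullback τ s f y

/-- `x` is the integral over the chain `c` of the form `f dt` with values in the vector space
`W`: after applying any linear functional, the integrals exist and agree. -/
def HasChainIntegral {W : Type*} [AddCommGroup W] [Module ℂ W]
    (c : Chain (∑ k, m k) (Coord m → ℂ)) (f : (Coord m → ℂ) → W) (x : W) : Prop :=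
  ∀ ξ : Module.Dual ℂ W,
    (∀ τ ∈ c.support, MeasureTheory.IntegrableOn (pullback τ (c τ) fun t => ξ (f t)) (corner _)) ∧
    chainIntegral c (fun t => ξ (f t)) = ξ x

theorem HasChainIntegral.unique {W : Type*} [AddCommGroup W] [Module ℂ W]
    {c : Chain (∑ k, m k) (Coord m → ℂ)} {f : (Coord m → ℂ) → W} {x y : W}
    (hx : HasChainIntegral c f x) (hy : HasChainIntegral c f y) : x = y := by
  rw [← sub_eq_zero, ← Module.forall_dual_apply_eq_zero_iff ℂ]
  intro ξ
  rw [map_sub, ← (hx ξ).2, ← (hy ξ).2, sub_self]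

open Classical in
/-- The integral of a vector-valued form over a chain (zero if it does not exist). -/
def vectorIntegral {W : Type*} [AddCommGroup W] [Module ℂ W]
    (c : Chain (∑ k, m k) (Coord m → ℂ)) (f : (Coord m → ℂ) → W) : W :=
  if h : ∃ x, HasChainIntegral c f x then h.choose else 0

/-- `f` is a rational function of `t` with poles in the union of the hyperplanes
`t_k^{(d)} = w_j` and `t_k^{(d)} = t_{k+1}^{(d')}`. -/
def IsRationalWithPoles {q : ℕ} (w : Fin q → ℂ) (f : (Coord m → ℂ) → ℂ) : Prop :=
  ∃ (P : MvPolynomial (Coord m) ℂ) (e : ℕ), ∀ t : Coord m → ℂ,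
    (∀ a j, t a ≠ w j) → (∀ a b : Coord m, (a.1 : ℕ) + 1 = b.1 → t a ≠ t b) →
    f t = MvPolynomial.eval t P /
      ((∏ a, ∏ j, (t a - w j)) *
        ∏ a : Coord m, ∏ b : Coord m, if (a.1 : ℕ) + 1 = b.1 then t a - t b else 1) ^ e

/-- The point `σ t`, for `σ` in the product of the symmetric groups `Σ_{m_k}`. -/
def permute (σ : ∀ k, Equiv.Perm (Fin (m k))) (t : Coord m → ℂ) : Coord m → ℂ :=
  fun a => t ⟨a.1, σ a.1 a.2⟩

/-- Matsuo's assumption on a chain: the integral of every rational function with poles in the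
above hyperplanes does not change when the coordinates are permuted within each group. The
multivalued function is invariant under these permutations, so that its branch stays the same. -/
def MatsuoAssumption {q : ℕ} (w : Fin q → ℂ) (c : Chain (∑ k, m k) (Coord m → ℂ)) : Prop :=
  ∀ f : (Coord m → ℂ) → ℂ, IsRationalWithPoles w f → ∀ σ : ∀ k, Equiv.Perm (Fin (m k)),
    chainIntegral c f = chainIntegral c fun t => f (permute σ t)

/-! ## The master functions -/

/-- The strict lexicographic order on the coordinates. -/
def CoordLT (a b : Coord m) : Prop := a.1 < b.1 ∨ (a.1 = b.1 ∧ (a.2 : ℕ) < b.2)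

instance : DecidableRel (CoordLT (m := m)) := fun a b =>
  inferInstanceAs (Decidable (a.1 < b.1 ∨ (a.1 = b.1 ∧ (a.2 : ℕ) < b.2)))

variable (m) in
/-- The index set of the factors of `Φ'`: the pairs `i < j`, the pairs `((k, d), j)`, and the
ordered pairs of coordinates. -/
abbrev Factors (p : ℕ) : Type :=
  {ij : Fin p × Fin p // ij.1 < ij.2} ⊕ (Coord m × Fin p) ⊕
    {ab : Coord m × Coord m // CoordLT ab.1 ab.2}

/-- The bases of the factors `z_i - z_j`, `t_k^{(d)} - z_j`, `t_k^{(d)} - t_l^{(d')}` of `Φ'`. -/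
def ratBase {p : ℕ} (z : Fin p → ℂ) : Factors m p → (Coord m → ℂ) → ℂ
  | .inl ij, _ => z ij.1.1 - z ij.1.2
  | .inr (.inl aj), t => t aj.1 - z aj.2
  | .inr (.inr ab), t => t ab.1.1 - t ab.1.2

/-- The exponents `(Λ_i, Λ_j)`, `-(α_k, Λ_j)`, `(α_k, α_l)` of the factors of `Φ'`. -/
def ratExp {p : ℕ} (Λ : Fin p → Cartan r) : Factors m p → ℂ
  | .inl ij => pair (Λ ij.1.1) (Λ ij.1.2)
  | .inr (.inl aj) => -pair (simpleRoot aj.1.1) (Λ aj.2)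
  | .inr (.inr ab) => pair (simpleRoot ab.1.1.1) (simpleRoot ab.1.2.1)

variable (m) in
/-- The weight `ν = ∑_j Λ_j - ∑_k m_k α_k`. -/
def nu {p : ℕ} (Λ : Fin p → Cartan r) : Cartan r :=
  ∑ j, Λ j - ∑ k : Fin r, (m k : ℂ) • simpleRoot k

/-- The bases of the factors of `Φ(z, t; λ)`: those of `Φ'`, the `t_k^{(d)}`, and the `z_i`. -/
def trigBase {p : ℕ} (z : Fin p → ℂ) : Factors m p ⊕ (Coord m ⊕ Fin p) → (Coord m → ℂ) → ℂ
  | .inl f, t => ratBase z f t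
  | .inr (.inl a), t => t a
  | .inr (.inr i), _ => z i

/-- The exponents of the factors of `Φ(z, t; λ)`: those of `Φ'`, then `-(α_k, λ - ρ - ν/2)` for
`t_k^{(d)}`, and `(Λ_i, λ - ν/2 + Λ_i/2)` for `z_i`. -/
def trigExp {p : ℕ} (Λ : Fin p → Cartan r) (lam : Cartan r) :
    Factors m p ⊕ (Coord m ⊕ Fin p) → ℂ
  | .inl f => ratExp Λ f
  | .inr (.inl a) => -pair (simpleRoot a.1) (lam - rho r - (2⁻¹ : ℂ) • nu m Λ)
  | .inr (.inr i) => pair (Λ i) (lam - (2⁻¹ : ℂ) • nu m Λ + (2⁻¹ : ℂ) • Λ i)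

variable (m) in
/-- Twisted cycles in `{z} × ℂ^m` for the multivalued function `Φ'(z, t)^{1/κ}`. -/
abbrev RatCycle {p : ℕ} (Λ : Fin p → Cartan r) (κ : ℂ) (z : Fin p → ℂ) : Type :=
  TwistedCycle m z (ratBase z) (ratExp Λ) κ

variable (m) in
/-- Twisted cycles in `{z} × ℂ^m` for the multivalued function `Φ(z, t; λ)^{1/κ}`. -/
abbrev TrigCycle {p : ℕ} (Λ : Fin p → Cartan r) (κ : ℂ) (lam : Cartan r) (z : Fin p → ℂ) : Type :=
  TwistedCycle m (Fin.snoc z 0 : Fin (p + 1) → ℂ) (trigBase z) (trigExp Λ lam) κ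

end Cycles

/-! ## Hypergeometric solutions

Here `U` is a set of configurations `z`, and `γ` any family of twisted cycles over `U`, for instance
a horizontal one. -/

section Solutions

variable {r p : ℕ} {m : Fin r → ℕ} {V : Fin p → Type*} [∀ j, AddCommGroup (V j)]
  [∀ j, Module ℂ (V j)] [∀ j, LieRingModule (SL r) (V j)] [∀ j, LieModule ℂ (SL r) (V j)]
  {Λ : Fin p → Cartan r} {κ : ℂ} {U : Set (Fin p → ℂ)}

/-- The hypergeometric solution `u(z) = ∫_{γ(z)} Φ'(z, t)^{1/κ} ∑_I φ(I) F_I v dt` of the rational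
KZ equations. -/
def ratSolution (v : ∀ j, V j) (β : Bijections m p) (γ : ∀ z : U, RatCycle m Λ κ z.1) (z : U) :
    PiTensorProduct ℂ V :=
  vectorIntegral (γ z).chain (stdForm v β z.1)

/-- The integral `∫_{γ(z)} Φ'(z, t)^{1/κ} ∑_I φ(I, h) F_I(h) v dt`. -/
def ratSolutionAt (v : ∀ j, V j) (β : Bijections m p) (γ : ∀ z : U, RatCycle m Λ κ z.1)
    (h : Fin r) (z : U) : PiTensorProduct ℂ V :=
  vectorIntegral (γ z).chain (specialForm v β h z.1)

/-- The hypergeometric solution `v(z, λ) = ∫_{γ(z)} Φ(z, t; λ)^{1/κ} ∑_I φ(I) F_I v dt` of the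
trigonometric KZ equations. -/
def trigSolution (v : ∀ j, V j) (β : Bijections m p) {lam : Cartan r}
    (γ : ∀ z : U, TrigCycle m Λ κ lam z.1) (z : U) : PiTensorProduct ℂ V :=
  vectorIntegral (γ z).chain (stdForm v β z.1)

/-- The integral `v(z, λ; h) = ∫_{γ(z)} Φ(z, t; λ)^{1/κ} ∑_I φ(I, h) F_I(h) v dt`. -/
def trigSolutionAt (v : ∀ j, V j) (β : Bijections m p) {lam : Cartan r}
    (γ : ∀ z : U, TrigCycle m Λ κ lam z.1) (h : Fin r) (z : U) : PiTensorProduct ℂ V :=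
  vectorIntegral (γ z).chain (specialForm v β h z.1)

end Solutions

end KZ

end

open KZ

/-! Matsuo's assumption lets an integrand be replaced by its average over the group Σ of
permutations of equally coloured coordinates. It therefore suffices that the two vector-valued
integrands have the same sum over Σ at every point of the complement (`sum_stdForm_permute`).
`TwistedCycle.eq_of_sum_permute_eq` passes from this pointwise identity to the integrals, which
exist because continuous functions are integrated over compact simplices.

For the pointwise identity, give each coordinate t_k^{(d)} a formal variable of square zero. For a
root α_{k,l}, a point z and a colour c, the element `rootElt` sums over all choices of one
coordinate of each colour k, …, l-1. Each term is the chain function times 1/(t_c - z), multiplied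
by the variables chosen. In a monomial in these elements, the coefficient of the product of all
variables retains the choices that use every coordinate exactly once, and this is a sum over Σ
(`sum_phi_permute`, `sum_phiAt_permute`). The factorials in the PBW monomials turn the sum over all
exponents into a product of exponentials exp(-y_a ⊗ e_{l,k}), taken in decreasing order of the
roots. The signs of F_{k,l}(h) cancel those of φ_h (`reversals_eq`). The tensor factors separate, so
only one z has to be treated: the ordered products for ≻_h and for the standard order must agree
(`orderedProd_rootElt`).

This is proved by comparing h with q = h+1. The roots starting at q move past those ending at q, and
the coefficients y_{k,l} change only for k < q < l. Since exp x exp y = exp [x,y] exp y exp x when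
[x,y] commutes with x and y, the move creates a correction on exactly these roots. The correction
matches the change when y'_{k,l} - y_{k,l} = y'_{q,l} y'_{k,q}. This is the partial fraction
identity of `rootFun_sub`. For the last h the order ≻_h is the standard one. -/

namespace KZ

/-! ### Exponentials of nilpotent elements -/

section NilpotentExp

variable {A : Type*} [Ring A] [Algebra ℚ A]

theorem semiconjBy_exp {e x y : A} (hx : IsNilpotent x) (hy : IsNilpotent y)
    (h : SemiconjBy e x y) : SemiconjBy e (IsNilpotent.exp x) (IsNilpotent.exp y) := by
  obtain ⟨n, hn⟩ := hx
  obtain ⟨k, hk⟩ := hy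
  rw [IsNilpotent.exp_eq_sum (pow_eq_zero_of_le (le_max_left n k) hn),
    IsNilpotent.exp_eq_sum (pow_eq_zero_of_le (le_max_right n k) hk)]
  unfold SemiconjBy
  rw [Finset.mul_sum, Finset.sum_mul]
  refine Finset.sum_congr rfl fun i _ => ?_
  rw [mul_smul_comm, smul_mul_assoc, (h.pow_right i).eq]

theorem commute_exp_right {e x : A} (hx : IsNilpotent x) (h : Commute e x) :
    Commute e (IsNilpotent.exp x) :=
  semiconjBy_exp hx hx h

theorem commute_exp_exp {x y : A} (hx : IsNilpotent x) (hy : IsNilpotent y) (h : Commute x y) :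
    Commute (IsNilpotent.exp x) (IsNilpotent.exp y) :=
  commute_exp_right hy (commute_exp_right hx h.symm).symm

theorem pow_succ_mul_of_commutator {x y z : A} (hz : x * y - y * x = z) (hxz : Commute x z)
    (n : ℕ) : x ^ (n + 1) * y = y * x ^ (n + 1) + ((n : ℚ) + 1) • (z * x ^ n) := by
  have hxy : x * y = y * x + z := by rw [← hz]; abel
  induction n with
  | zero => simp [hxy]
  | succ n ih =>
    have hzx : x * (z * x ^ n) = z * x ^ (n + 1) := by
      rw [← mul_assoc, hxz.eq, mul_assoc, ← pow_succ']
    rw [pow_succ' x (n + 1), mul_assoc, ih, mul_add, ← mul_assoc x y, hxy, mul_smul_comm, hzx,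
      add_mul, mul_assoc y, add_assoc]
    congr 1
    push_cast
    module

/-- Multiplying by exp x acts as the derivation [x, ·], which sends y to z and stops there because x
commutes with z. -/
theorem semiconjBy_exp_add {x y z : A} (hx : IsNilpotent x) (hz : x * y - y * x = z)
    (hxz : Commute x z) : SemiconjBy (IsNilpotent.exp x) y (y + z) := by
  obtain ⟨n, hn⟩ := hx
  -- The commutator lowers the power of x by one, so exp x is truncated at n + 1 terms next to y and
  -- at n terms next to z. The two sums then match term by term.
  have e1 := IsNilpotent.exp_eq_sum (pow_eq_zero_of_le n.le_succ hn)
  have e2 := IsNilpotent.exp_eq_sum hn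
  unfold SemiconjBy
  rw [add_mul]
  nth_rw 3 [e2]
  rw [e1, Finset.sum_mul, Finset.sum_range_succ', Finset.mul_sum,
    Finset.sum_range_succ' (fun i => y * _), Finset.mul_sum]
  rw [add_right_comm, ← Finset.sum_add_distrib]
  congr 1
  · refine Finset.sum_congr rfl fun i _ => ?_
    rw [smul_mul_assoc, pow_succ_mul_of_commutator hz hxz, smul_add, mul_smul_comm, mul_smul_comm,
      smul_smul, Nat.factorial_succ]
    congr 2
    have : (i.factorial : ℚ) ≠ 0 := by exact_mod_cast i.factorial_ne_zero
    push_cast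
    field_simp
  · simp

/-- Moving exp x to the right turns y into y + z, hence exp y into exp (y + z), which splits because
y and z commute. -/
theorem exp_mul_exp_of_commutator {x y z : A} (hx : IsNilpotent x) (hy : IsNilpotent y)
    (hz : IsNilpotent z) (h : x * y - y * x = z) (hxz : Commute x z) (hyz : Commute y z) :
    IsNilpotent.exp x * IsNilpotent.exp y =
      IsNilpotent.exp z * IsNilpotent.exp y * IsNilpotent.exp x := by
  rw [(semiconjBy_exp hy (hyz.isNilpotent_add hy hz) (semiconjBy_exp_add hx h hxz)).eq,
    add_comm y z, IsNilpotent.exp_add_of_commute hyz.symm hz hy]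

theorem isNilpotent_sum_and_prod_map_exp {ι : Type*} (X : ι → A) (l : List ι)
    (hnil : ∀ a ∈ l, IsNilpotent (X a))
    (hcomm : ∀ a ∈ l, ∀ b ∈ l, Commute (X a) (X b)) :
    IsNilpotent (l.map X).sum ∧
      (l.map fun a => IsNilpotent.exp (X a)).prod = IsNilpotent.exp (l.map X).sum := by
  induction l with
  | nil => simp
  | cons a l ih =>
    simp only [List.mem_cons, forall_eq_or_imp] at hnil hcomm
    obtain ⟨h1, h2⟩ := ih hnil.2 fun b hb c hc => (hcomm.2 b hb).2 c hc
    have h3 : Commute (X a) (l.map X).sum := by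
      refine Commute.list_sum_right _ _ fun x hx => ?_
      obtain ⟨b, hb, rfl⟩ := List.mem_map.1 hx
      exact hcomm.1.2 b hb
    simp only [List.map_cons, List.sum_cons, List.prod_cons]
    exact ⟨h3.isNilpotent_add hnil.1 h1,
      by rw [h2, IsNilpotent.exp_add_of_commute h3 hnil.1 h1]⟩

end NilpotentExp

/-! ### Products over positive roots in decreasing order -/

section OrderedProducts

variable {r : ℕ} {R : PosRoot r → PosRoot r → Prop} (hR : IsLinear R)

theorem mem_sortedRoots (a : PosRoot r) : a ∈ sortedRoots R hR := by
  classical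
  simp [sortedRoots]

theorem sortedRoots_nodup : (sortedRoots R hR).Nodup := by
  unfold sortedRoots
  simp only [Finset.sort_nodup]

theorem sortedRoots_pairwise : (sortedRoots R hR).Pairwise R := by
  have h1 : (sortedRoots R hR).Pairwise fun a b => a = b ∨ R a b := by
    unfold sortedRoots
    simp only [Finset.pairwise_sort]
  exact (h1.and (sortedRoots_nodup hR)).imp fun h => h.1.resolve_left h.2

variable {M : Type*} [Monoid M]

/-- The product of the `f a`, `a ∈ S`, in decreasing order. -/
noncomputable def orderedProd (S : Finset (PosRoot r)) (f : PosRoot r → M) : M :=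
  (((sortedRoots R hR).filter (· ∈ S)).map f).prod

/-- A finite set has only one decreasing enumeration for a strict linear order, so any decreasing
list computes the product. -/
theorem orderedProd_eq_of_pairwise {S : Finset (PosRoot r)} (f : PosRoot r → M)
    {l : List (PosRoot r)} (hl : l.Pairwise R) (hS : ∀ a, a ∈ l ↔ a ∈ S) : orderedProd hR S f = (l.map f).prod := by
  unfold orderedProd
  congr 2
  refine List.Perm.eq_of_pairwise (le := R)
    (fun a b _ _ hab hba => absurd (hR.trans _ _ _ hab hba) (hR.irrefl a))
    ((sortedRoots_pairwise hR).filter _) hl ?_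
  have hl' : l.Nodup := by
    refine List.Pairwise.imp (fun {a b} h e => ?_) hl
    rw [e] at h
    exact hR.irrefl _ h
  refine (List.perm_ext_iff_of_nodup ((sortedRoots_nodup hR).filter _) hl').2 fun a => ?_
  simp [mem_sortedRoots, hS]

theorem exists_sorted_list (hR : IsLinear R) (S : Finset (PosRoot r)) :
    ∃ l : List (PosRoot r), l.Pairwise R ∧ l.Nodup ∧ (∀ a, a ∈ l ↔ a ∈ S) := by
  refine ⟨(sortedRoots R hR).filter (· ∈ S), (sortedRoots_pairwise hR).filter _,
    (sortedRoots_nodup hR).filter _, fun a => ?_⟩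
  simp [mem_sortedRoots]

theorem orderedProd_univ (f : PosRoot r → M) :
    orderedProd hR Finset.univ f = ((sortedRoots R hR).map f).prod :=
  orderedProd_eq_of_pairwise hR f (sortedRoots_pairwise hR) fun a => by simp [mem_sortedRoots]

theorem orderedProd_union {S T : Finset (PosRoot r)} (h : ∀ a ∈ S, ∀ b ∈ T, R a b)
    (f : PosRoot r → M) :
    orderedProd hR (S ∪ T) f = orderedProd hR S f * orderedProd hR T f := by
  obtain ⟨l, h1, -, h2⟩ := exists_sorted_list hR S
  obtain ⟨l', h1', -, h2'⟩ := exists_sorted_list hR T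
  rw [orderedProd_eq_of_pairwise hR f h1 h2, orderedProd_eq_of_pairwise hR f h1' h2',
    ← List.prod_append, ← List.map_append]
  refine orderedProd_eq_of_pairwise hR f (List.pairwise_append.2 ⟨h1, h1', ?_⟩) ?_
  · exact fun a ha b hb => h a ((h2 a).1 ha) b ((h2' b).1 hb)
  · simp [h2, h2']

theorem orderedProd_congr {R' : PosRoot r → PosRoot r → Prop} (hR' : IsLinear R')
    {S : Finset (PosRoot r)} (h : ∀ a ∈ S, ∀ b ∈ S, R a b → R' a b) {f g : PosRoot r → M}
    (hfg : ∀ a ∈ S, f a = g a) : orderedProd hR S f = orderedProd hR' S g := by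
  obtain ⟨l, h1, -, h2⟩ := exists_sorted_list hR S
  rw [orderedProd_eq_of_pairwise hR f h1 h2, orderedProd_eq_of_pairwise hR' g _ h2]
  · congr 1
    exact List.map_congr_left fun a ha => hfg a ((h2 a).1 ha)
  · exact h1.imp_of_mem fun ha hb hab => h _ ((h2 _).1 ha) _ ((h2 _).1 hb) hab

theorem commute_orderedProd {S : Finset (PosRoot r)} {f : PosRoot r → M} {x : M}
    (h : ∀ a ∈ S, Commute x (f a)) : Commute x (orderedProd hR S f) := by
  obtain ⟨l, h1, -, h2⟩ := exists_sorted_list hR S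
  rw [orderedProd_eq_of_pairwise hR f h1 h2]
  refine Commute.list_prod_right _ _ fun y hy => ?_
  obtain ⟨a, ha, rfl⟩ := List.mem_map.1 hy
  exact h a ((h2 a).1 ha)

theorem orderedProd_exp_of_commute {A : Type*} [Ring A] [Algebra ℚ A] (S : Finset (PosRoot r))
    (X : PosRoot r → A) (hnil : ∀ a ∈ S, IsNilpotent (X a))
    (hcomm : ∀ a ∈ S, ∀ b ∈ S, Commute (X a) (X b)) :
    IsNilpotent (∑ a ∈ S, X a) ∧
      orderedProd hR S (fun a => IsNilpotent.exp (X a)) =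
        IsNilpotent.exp (∑ a ∈ S, X a) := by
  obtain ⟨l, h1, h3, h2⟩ := exists_sorted_list hR S
  have e : ∑ a ∈ S, X a = (l.map X).sum := by
    rw [← List.sum_toFinset _ h3]
    exact Finset.sum_congr (by ext; simp [h2]) fun _ _ => rfl
  rw [orderedProd_eq_of_pairwise hR _ h1 h2, e]
  exact isNilpotent_sum_and_prod_map_exp X l (fun a ha => hnil a ((h2 a).1 ha))
    fun a ha b hb => hcomm a ((h2 a).1 ha) b ((h2 b).1 hb)

end OrderedProducts

/-! ### Commutators of lowering operators -/

section Brackets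

variable {r : ℕ}

theorem lie_lowering_eq_zero {a b : PosRoot r} (h₁ : a.1.1 ≠ b.1.2) (h₂ : b.1.1 ≠ a.1.2) :
    ⁅lowering a, lowering b⁆ = 0 := by
  apply Subtype.ext
  rw [LieSubalgebra.coe_bracket, Ring.lie_def]
  simp [lowering, LieAlgebra.SpecialLinear.val_single, h₁, h₂]

theorem lie_lowering_lowering {a b c : PosRoot r} (h₁ : a.1.1 = b.1.2) (h₂ : c.1.1 = b.1.1)
    (h₃ : c.1.2 = a.1.2) : ⁅lowering a, lowering b⁆ = lowering c := by
  have h₄ : b.1.1 ≠ a.1.2 := by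
    have h := (b.2.trans_eq h₁.symm).trans a.2
    exact h.ne
  apply Subtype.ext
  rw [LieSubalgebra.coe_bracket, Ring.lie_def]
  simp [lowering, LieAlgebra.SpecialLinear.val_single, h₁, h₂, h₃, h₄]

end Brackets

theorem exists_finset_mem_iff {α : Type*} [Fintype α] (P : α → Prop) :
    ∃ A : Finset α, ∀ a, a ∈ A ↔ P a := by
  classical
  exact ⟨Finset.univ.filter P, by simp⟩

/-- The bookkeeping of the step from h to h + 1: x and y are the exponentials for the roots starting
and ending at h + 1, z is their correction, and a', a are the factors for the roots through h + 1.
-/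
theorem mul_rearrange {M : Type*} [Monoid M] {a a' z x y b c : M} (h₁ : x * y = z * y * x)
    (h₂ : a' * z = a) (h₃ : Commute x b) :
    a' * x * (y * (b * c)) = a * y * (b * (x * c)) := by
  calc a' * x * (y * (b * c)) = a' * (x * y) * (b * c) := by simp only [mul_assoc]
    _ = a' * z * y * (x * b) * c := by rw [h₁]; simp only [mul_assoc]
    _ = a * y * (b * (x * c)) := by rw [h₂, h₃.eq]; simp only [mul_assoc]

/-! ### Comparing ordered products of exponentials for different orders -/

section RootTerms

variable {r : ℕ} {S : Type*} [CommRing S] [Algebra ℂ S]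

/-- The element `-y_a ⊗ e_{l,k}`, `a = α_{k,l}`, of `S ⊗ U(sl_N)`. -/
noncomputable def rootTerm (y : PosRoot r → S) (a : PosRoot r) :
    S ⊗[ℂ] UniversalEnvelopingAlgebra ℂ (SL r) :=
  -(y a ⊗ₜ[ℂ] UniversalEnvelopingAlgebra.ι ℂ (lowering a))

theorem rootTerm_commutator (y : PosRoot r → S) (a b : PosRoot r) :
    rootTerm y a * rootTerm y b - rootTerm y b * rootTerm y a =
      (y a * y b) ⊗ₜ[ℂ] UniversalEnvelopingAlgebra.ι ℂ ⁅lowering a, lowering b⁆ := by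
  rw [LieHom.map_lie, Ring.lie_def, TensorProduct.tmul_sub]
  simp only [rootTerm, neg_mul_neg, Algebra.TensorProduct.tmul_mul_tmul, mul_comm (y b)]

theorem commute_rootTerm (y y' : PosRoot r → S) {a b : PosRoot r} (h₁ : a.1.1 ≠ b.1.2)
    (h₂ : b.1.1 ≠ a.1.2) : Commute (rootTerm y a) (rootTerm y' b) := by
  have h : Commute (UniversalEnvelopingAlgebra.ι ℂ (lowering a))
      (UniversalEnvelopingAlgebra.ι ℂ (lowering b)) := by
    rw [commute_iff_lie_eq, ← LieHom.map_lie, lie_lowering_eq_zero h₁ h₂, map_zero]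
  refine Commute.neg_left (Commute.neg_right ?_)
  rw [commute_iff_eq, Algebra.TensorProduct.tmul_mul_tmul, Algebra.TensorProduct.tmul_mul_tmul,
    h.eq, mul_comm]

theorem isNilpotent_rootTerm {y : PosRoot r → S} {a : PosRoot r} (h : IsNilpotent (y a)) :
    IsNilpotent (rootTerm y a) := by
  obtain ⟨n, hn⟩ := h
  refine IsNilpotent.neg ⟨n, ?_⟩
  rw [Algebra.TensorProduct.tmul_pow, hn, TensorProduct.zero_tmul]

/-- A root through c splits uniquely at c into one ending at c and one starting there, and the
matrix units of the two halves bracket to that of the whole. The relation `hrel` turns the product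
of coefficients into a difference; the minus sign in `rootTerm` accounts for the order of that
difference. -/
theorem sum_rootTerm_commutator {c : Fin r} {y y' : PosRoot r → S} {A H K : Finset (PosRoot r)}
    (hA : ∀ a, a ∈ A ↔ (a.1.1 : ℕ) < c ∧ (c : ℕ) < a.1.2)
    (hH : ∀ a, a ∈ H ↔ (a.1.1 : ℕ) = c) (hK : ∀ a, a ∈ K ↔ (a.1.2 : ℕ) = c)
    (hrel : ∀ a b d : PosRoot r, (a.1.2 : ℕ) = c → (b.1.1 : ℕ) = c → d.1.1 = a.1.1 →
      d.1.2 = b.1.2 → y' d - y d = y' b * y' a) :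
    (∑ a ∈ H, rootTerm y' a) * (∑ a ∈ K, rootTerm y' a) -
        (∑ a ∈ K, rootTerm y' a) * (∑ a ∈ H, rootTerm y' a) =
      ∑ a ∈ A, rootTerm y a - ∑ a ∈ A, rootTerm y' a := by
  rw [Finset.sum_mul_sum, Finset.sum_mul_sum, Finset.sum_comm (s := K),
    ← Finset.sum_sub_distrib, ← Finset.sum_sub_distrib]
  simp_rw [← Finset.sum_sub_distrib, rootTerm_commutator]
  rw [← Finset.sum_product']
  refine Finset.sum_bij (fun x hx => ⟨(x.2.1.1, x.1.1.2), ?_⟩) ?_ ?_ ?_ ?_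
  · simp only [Finset.mem_product, hH, hK] at hx
    have := x.1.2
    have := x.2.2
    change x.2.1.1 < x.1.1.2
    omega
  · rintro ⟨b, a⟩ hx
    simp only [Finset.mem_product, hH, hK] at hx
    simp only [hA]
    have := a.2
    have := b.2
    omega
  · rintro ⟨b, a⟩ hx ⟨b', a'⟩ hx' e
    simp only [Finset.mem_product, hH, hK] at hx hx'
    simp only [Subtype.mk.injEq, Prod.mk.injEq] at e
    refine Prod.ext (Subtype.ext (Prod.ext (Fin.ext ?_) e.2))
      (Subtype.ext (Prod.ext e.1 (Fin.ext ?_)))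
    · exact hx.1.trans hx'.1.symm
    · exact hx.2.trans hx'.2.symm
  · intro d hd
    simp only [hA] at hd
    refine ⟨(⟨(c.castSucc, d.1.2), hd.2⟩, ⟨(d.1.1, c.castSucc), hd.1⟩), ?_, rfl⟩
    simp [hH, hK]
  · rintro ⟨b, a⟩ hx
    simp only [Finset.mem_product, hH, hK] at hx
    have hlt : a.1.1 < b.1.2 := by
      have := a.2
      have := b.2
      omega
    rw [lie_lowering_lowering (c := ⟨(a.1.1, b.1.2), hlt⟩) (Fin.ext (hx.1.trans hx.2.symm))
      rfl rfl, ← hrel a b ⟨(a.1.1, b.1.2), hlt⟩ hx.2 hx.1 rfl rfl]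
    simp only [rootTerm, TensorProduct.sub_tmul]
    abel

variable [Algebra ℚ S]

/-- Let A, H, K, B, C be the roots through h', starting at h', ending at h', lying before h', and
lying after h'. In the order for h' the blocks come as (A ∪ H), K, B, C; in the order for h they
come as (A ∪ K), B, H, C. The families A ∪ H and A ∪ K each commute, so the essential change is
moving H past K, which creates exp (XA - XA'). -/
theorem orderedProd_succ_step {h h' : Fin r} (hh : (h : ℕ) + 1 = h') {y y' : PosRoot r → S}
    (hnil : ∀ a, IsNilpotent (y a)) (hnil' : ∀ a, IsNilpotent (y' a))
    (hsame : ∀ a : PosRoot r, ¬ ((a.1.1 : ℕ) < h' ∧ (h' : ℕ) < a.1.2) → y' a = y a)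
    (hrel : ∀ a b c : PosRoot r, (a.1.2 : ℕ) = h' → (b.1.1 : ℕ) = h' → c.1.1 = a.1.1 →
      c.1.2 = b.1.2 → y' c - y c = y' b * y' a) :
    orderedProd (succ_isLinear h') Finset.univ (fun a => IsNilpotent.exp (rootTerm y' a)) =
      orderedProd (succ_isLinear h) Finset.univ (fun a => IsNilpotent.exp (rootTerm y a)) := by
  obtain ⟨A, hA⟩ : ∃ A : Finset (PosRoot r), ∀ a, a ∈ A ↔ (a.1.1 : ℕ) < h' ∧ (h' : ℕ) < a.1.2 :=
    exists_finset_mem_iff _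
  obtain ⟨H, hH⟩ : ∃ H : Finset (PosRoot r), ∀ a, a ∈ H ↔ (a.1.1 : ℕ) = h' :=
    exists_finset_mem_iff _
  obtain ⟨K, hK⟩ : ∃ K : Finset (PosRoot r), ∀ a, a ∈ K ↔ (a.1.2 : ℕ) = h' :=
    exists_finset_mem_iff _
  obtain ⟨B, hB⟩ : ∃ B : Finset (PosRoot r), ∀ a, a ∈ B ↔ (a.1.2 : ℕ) < h' :=
    exists_finset_mem_iff _
  obtain ⟨C, hC⟩ : ∃ C : Finset (PosRoot r), ∀ a, a ∈ C ↔ (h' : ℕ) < a.1.1 :=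
    exists_finset_mem_iff _
  have e1 : (Finset.univ : Finset (PosRoot r)) = (A ∪ H) ∪ (K ∪ (B ∪ C)) := by
    ext a
    simp only [Finset.mem_univ, Finset.mem_union, hA, hH, hK, hB, hC, true_iff]
    omega
  have e2 : (Finset.univ : Finset (PosRoot r)) = (A ∪ K) ∪ (B ∪ (H ∪ C)) := by
    rw [e1]
    ext a
    simp only [Finset.mem_union]
    tauto
  have hAH : Disjoint A H := by
    rw [Finset.disjoint_left]
    simp only [hA, hH]
    omega
  have hAK : Disjoint A K := by
    rw [Finset.disjoint_left]
    simp only [hA, hK]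
    omega
  have cAH : ∀ u v : PosRoot r → S, ∀ a ∈ A ∪ H, ∀ b ∈ A ∪ H,
      Commute (rootTerm u a) (rootTerm v b) := by
    intro u v a ha b hb
    have := a.2
    have := b.2
    simp only [Finset.mem_union, hA, hH] at ha hb
    refine commute_rootTerm u v ?_ ?_ <;> rw [Ne, Fin.ext_iff] <;> omega
  have cAK : ∀ u v : PosRoot r → S, ∀ a ∈ A ∪ K, ∀ b ∈ A ∪ K,
      Commute (rootTerm u a) (rootTerm v b) := by
    intro u v a ha b hb
    have := a.2
    have := b.2
    simp only [Finset.mem_union, hA, hK] at ha hb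
    refine commute_rootTerm u v ?_ ?_ <;> rw [Ne, Fin.ext_iff] <;> omega
  have cHB : ∀ a ∈ H, ∀ b ∈ B, Commute (rootTerm y' a) (rootTerm y b) := by
    intro a ha b hb
    have := a.2
    have := b.2
    simp only [hH, hB] at ha hb
    refine commute_rootTerm y' y ?_ ?_ <;> rw [Ne, Fin.ext_iff] <;> omega
  have nil : ∀ a, IsNilpotent (rootTerm y a) := fun a => isNilpotent_rootTerm (hnil a)
  have nil' : ∀ a, IsNilpotent (rootTerm y' a) := fun a => isNilpotent_rootTerm (hnil' a)
  set XA' := ∑ a ∈ A, rootTerm y' a with hXA'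
  set XA := ∑ a ∈ A, rootTerm y a with hXA
  set XH := ∑ a ∈ H, rootTerm y' a with hXH
  set XK := ∑ a ∈ K, rootTerm y' a with hXK
  have hcomm : XH * XK - XK * XH = XA - XA' := sum_rootTerm_commutator hA hH hK hrel
  have hsame' : ∀ a : PosRoot r, a ∉ A → rootTerm y' a = rootTerm y a := fun a ha => by
    simp only [rootTerm, hsame a (fun e => ha ((hA a).2 e))]
  have notA : ∀ a ∈ H ∪ (K ∪ (B ∪ C)), a ∉ A := by
    intro a ha
    simp only [Finset.mem_union, hA, hH, hK, hB, hC] at ha ⊢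
    omega
  have sum_comm' : ∀ (u v : PosRoot r → S) (T T' : Finset (PosRoot r)),
      (∀ a ∈ T, ∀ b ∈ T', Commute (rootTerm u a) (rootTerm v b)) →
        Commute (∑ a ∈ T, rootTerm u a) (∑ a ∈ T', rootTerm v a) :=
    fun u v T T' hx => Commute.sum_left _ _ _ fun a ha => Commute.sum_right _ _ _ fun b hb =>
      hx a ha b hb
  have subA : A ⊆ A ∪ H := Finset.subset_union_left
  have subH : H ⊆ A ∪ H := Finset.subset_union_right
  have subA' : A ⊆ A ∪ K := Finset.subset_union_left
  have subK : K ⊆ A ∪ K := Finset.subset_union_right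
  have nA' : IsNilpotent XA' := (orderedProd_exp_of_commute (succ_isLinear h') A _
    (fun a _ => nil' a) fun a ha b hb => cAH y' y' a (subA ha) b (subA hb)).1
  have nA : IsNilpotent XA := (orderedProd_exp_of_commute (succ_isLinear h') A _
    (fun a _ => nil a) fun a ha b hb => cAH y y a (subA ha) b (subA hb)).1
  have nH : IsNilpotent XH := (orderedProd_exp_of_commute (succ_isLinear h') H _
    (fun a _ => nil' a) fun a ha b hb => cAH y' y' a (subH ha) b (subH hb)).1
  have nK : IsNilpotent XK := (orderedProd_exp_of_commute (succ_isLinear h') K _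
    (fun a _ => nil' a) fun a ha b hb => cAK y' y' a (subK ha) b (subK hb)).1
  have cAA' : Commute XA XA' := sum_comm' _ _ _ _ fun a ha b hb => cAH _ _ a (subA ha) b (subA hb)
  have cHA : Commute XH XA := sum_comm' _ _ _ _ fun a ha b hb => cAH _ _ a (subH ha) b (subA hb)
  have cHA' : Commute XH XA' := sum_comm' _ _ _ _ fun a ha b hb => cAH _ _ a (subH ha) b (subA hb)
  have cKA : Commute XK XA := sum_comm' _ _ _ _ fun a ha b hb => cAK _ _ a (subK ha) b (subA' hb)
  have cKA' : Commute XK XA' := sum_comm' _ _ _ _ fun a ha b hb => cAK _ _ a (subK ha) b (subA' hb)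
  have nZ : IsNilpotent (XA - XA') := cAA'.isNilpotent_sub nA nA'
  have eAH : orderedProd (succ_isLinear h') (A ∪ H) (fun a => IsNilpotent.exp (rootTerm y' a)) =
      IsNilpotent.exp XA' * IsNilpotent.exp XH := by
    rw [(orderedProd_exp_of_commute (succ_isLinear h') (A ∪ H) _ (fun a _ => nil' a)
      (cAH y' y')).2, Finset.sum_union hAH,
      IsNilpotent.exp_add_of_commute cHA'.symm nA' nH]
  have eK' : ∑ a ∈ K, rootTerm y a = XK := Finset.sum_congr rfl fun a ha =>
    (hsame' a (notA a (by simp [ha]))).symm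
  have eAK : orderedProd (succ_isLinear h) (A ∪ K) (fun a => IsNilpotent.exp (rootTerm y a)) =
      IsNilpotent.exp XA * IsNilpotent.exp XK := by
    rw [(orderedProd_exp_of_commute (succ_isLinear h) (A ∪ K) _ (fun a _ => nil a)
      (cAK y y)).2, Finset.sum_union hAK, eK',
      IsNilpotent.exp_add_of_commute cKA.symm nA nK]
  have eK : orderedProd (succ_isLinear h') K (fun a => IsNilpotent.exp (rootTerm y' a)) =
      IsNilpotent.exp XK :=
    (orderedProd_exp_of_commute (succ_isLinear h') K _ (fun a _ => nil' a)
      fun a ha b hb => cAK y' y' a (subK ha) b (subK hb)).2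
  have eH : orderedProd (succ_isLinear h) H (fun a => IsNilpotent.exp (rootTerm y a)) =
      IsNilpotent.exp XH := by
    rw [(orderedProd_exp_of_commute (succ_isLinear h) H _ (fun a _ => nil a)
      fun a ha b hb => cAH y y a (subH ha) b (subH hb)).2]
    congr 1
    exact Finset.sum_congr rfl fun a ha =>
      (hsame' a (notA a (by simp [ha]))).symm
  have eB : orderedProd (succ_isLinear h') B (fun a => IsNilpotent.exp (rootTerm y' a)) =
      orderedProd (succ_isLinear h) B (fun a => IsNilpotent.exp (rootTerm y a)) := by
    refine orderedProd_congr _ _ (fun a ha b hb => ?_) fun a ha => ?_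
    · simp only [hB] at ha hb
      have := a.2
      have := b.2
      simp only [Succ, StdSucc, InA, InB, InC, Fin.le_def, Fin.lt_def, Fin.ext_iff,
        Fin.val_castSucc] at *
      omega
    · rw [hsame' a (notA a (by simp [ha]))]
  have eC : orderedProd (succ_isLinear h') C (fun a => IsNilpotent.exp (rootTerm y' a)) =
      orderedProd (succ_isLinear h) C (fun a => IsNilpotent.exp (rootTerm y a)) := by
    refine orderedProd_congr _ _ (fun a ha b hb => ?_) fun a ha => ?_
    · simp only [hC] at ha hb
      have := a.2
      have := b.2
      simp only [Succ, StdSucc, InA, InB, InC, Fin.le_def, Fin.lt_def, Fin.ext_iff,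
        Fin.val_castSucc] at *
      omega
    · rw [hsame' a (notA a (by simp [ha]))]
  have cHPB : Commute (IsNilpotent.exp XH)
      (orderedProd (succ_isLinear h) B (fun a => IsNilpotent.exp (rootTerm y a))) := by
    refine commute_orderedProd _ fun b hb => commute_exp_exp nH (nil b) ?_
    exact Commute.sum_left _ _ _ fun a ha => cHB a ha b hb
  -- The correction produced by exchanging H and K converts the new coefficients on A into the old
  -- ones.
  have eZ : IsNilpotent.exp XA' * IsNilpotent.exp (XA - XA') = IsNilpotent.exp XA := by
    rw [← IsNilpotent.exp_add_of_commute (cAA'.symm.sub_right (Commute.refl _)) nA' nZ,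
      add_sub_cancel]
  have hHK := exp_mul_exp_of_commutator nH nK nZ hcomm (cHA.sub_right cHA') (cKA.sub_right cKA')
  nth_rw 2 [e2]
  rw [e1, orderedProd_union _ (S := A ∪ H), eAH, orderedProd_union _ (S := K), eK,
    orderedProd_union _ (S := B), eB, eC, orderedProd_union _ (S := A ∪ K), eAK,
    orderedProd_union _ (S := B), orderedProd_union _ (S := H), eH]
  · exact mul_rearrange hHK eZ cHPB
  all_goals
    intro a ha b hb
    have := a.2
    have := b.2
    simp only [Finset.mem_union, hA, hH, hK, hB, hC, Succ, StdSucc, InA, InB, InC,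
      Fin.le_def, Fin.lt_def, Fin.ext_iff, Fin.val_castSucc] at *
    omega

theorem orderedProd_succ_eq_std (y : Fin r → PosRoot r → S) (ystd : PosRoot r → S)
    (hnil : ∀ h a, IsNilpotent (y h a))
    (hsame : ∀ h h' : Fin r, (h : ℕ) + 1 = h' → ∀ a : PosRoot r,
      ¬ ((a.1.1 : ℕ) < h' ∧ (h' : ℕ) < a.1.2) → y h' a = y h a)
    (hrel : ∀ h h' : Fin r, (h : ℕ) + 1 = h' → ∀ a b c : PosRoot r, (a.1.2 : ℕ) = h' →
      (b.1.1 : ℕ) = h' → c.1.1 = a.1.1 → c.1.2 = b.1.2 → y h' c - y h c = y h' b * y h' a)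
    (hlast : ∀ h : Fin r, (h : ℕ) + 1 = r → y h = ystd) (h : Fin r) :
    orderedProd (succ_isLinear h) Finset.univ (fun a => IsNilpotent.exp (rootTerm (y h) a)) =
      orderedProd (stdSucc_isLinear r) Finset.univ
        (fun a => IsNilpotent.exp (rootTerm ystd a)) := by
  -- Induction on the distance from h to the last colour. There C_h is empty and A_h consists of the
  -- roots with the largest l, so ≻_h is the standard order.
  obtain ⟨n, hn⟩ : ∃ n, (h : ℕ) + 1 + n = r := ⟨r - (h + 1), by omega⟩
  induction n generalizing h with
  | zero =>
    refine orderedProd_congr _ _ (fun a _ b _ hab => ?_) fun a _ => by rw [hlast h hn]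
    have := a.2
    have := b.2
    have := a.1.2.isLt
    have := b.1.2.isLt
    simp only [Succ, StdSucc, InA, InB, InC, Fin.le_def, Fin.lt_def, Fin.ext_iff,
      Fin.val_castSucc] at *
    omega
  | succ n ih =>
    have hlt : (h : ℕ) + 1 < r := by omega
    rw [← ih ⟨h + 1, hlt⟩ (by simp only; omega)]
    exact (orderedProd_succ_step rfl (hnil _) (hnil _) (hsame h ⟨h + 1, hlt⟩ rfl)
      (hrel h ⟨h + 1, hlt⟩ rfl)).symm

end RootTerms
-- Generating series of PBW monomials
section Expansion

/-- Distributivity in a noncommutative ring: the product in the order of the list is multilinear in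
its factors. -/
theorem list_prod_map_sum {A α : Type*} [Ring A] [Algebra ℂ A] [Fintype α] [DecidableEq α]
    {l : List α} (hl : l.Nodup) (hmem : ∀ a, a ∈ l) {κ : Type*} (s : α → Finset κ)
    (g : α → κ → A) :
    (l.map fun a => ∑ k ∈ s a, g a k).prod =
      ∑ i ∈ Fintype.piFinset s, (l.map fun a => g a (i a)).prod := by
  let e : Fin l.length ≃ α := hl.getEquivOfForallMemList l hmem
  let f : MultilinearMap ℂ (fun _ : α => A) A :=
    (MultilinearMap.mkPiAlgebraFin ℂ l.length A).domDomCongr e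
  have hf : ∀ x : α → A, f x = (l.map x).prod := by
    intro x
    change MultilinearMap.mkPiAlgebraFin ℂ l.length A (fun i => x (e i)) = _
    rw [MultilinearMap.mkPiAlgebraFin_apply]
    congr 1
    conv_rhs => rw [← List.ofFn_get l, List.map_ofFn]
    rfl
  simp only [← hf]
  exact f.map_sum_finset g s

theorem list_prod_tmul {S A α : Type*} [CommRing S] [Algebra ℂ S] [Ring A] [Algebra ℂ A]
    (l : List α) (c : α → S) (u : α → A) :
    (l.map fun a => c a ⊗ₜ[ℂ] u a).prod = (l.map c).prod ⊗ₜ[ℂ] (l.map u).prod := by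
  induction l with
  | nil => rfl
  | cons a l ih =>
    simp only [List.map_cons, List.prod_cons, ih, Algebra.TensorProduct.tmul_mul_tmul]

variable {r : ℕ} {S : Type*} [CommRing S] [Algebra ℂ S]
  {R : PosRoot r → PosRoot r → Prop} (hR : IsLinear R)

theorem prod_sortedRoots {M : Type*} [CommMonoid M] (f : PosRoot r → M) :
    ((sortedRoots R hR).map f).prod = ∏ a, f a := by
  rw [← List.prod_toFinset f (sortedRoots_nodup hR)]
  exact Finset.prod_congr (by ext; simp [mem_sortedRoots]) fun _ _ => rfl

theorem tmul_pbwMonomial (c : PosRoot r → S) (F : PosRoot r → SL r) (i : PosRoot r → ℕ) :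
    (∏ a, c a ^ i a) ⊗ₜ[ℂ] pbwMonomial R hR F i =
      ((sortedRoots R hR).map fun a => ((i a).factorial : ℂ)⁻¹ •
        (-(c a ⊗ₜ[ℂ] UniversalEnvelopingAlgebra.ι ℂ (F a))) ^ i a).prod := by
  have h1 : ∀ a, ((i a).factorial : ℂ)⁻¹ •
      (-(c a ⊗ₜ[ℂ] UniversalEnvelopingAlgebra.ι ℂ (F a))) ^ i a =
      (((-1 : ℂ) ^ i a) • c a ^ i a) ⊗ₜ[ℂ]
        (((i a).factorial : ℂ)⁻¹ • UniversalEnvelopingAlgebra.ι ℂ (F a) ^ i a) := by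
    intro a
    rw [← neg_one_smul ℂ, smul_pow, Algebra.TensorProduct.tmul_pow, TensorProduct.tmul_smul,
      TensorProduct.smul_tmul']
  simp only [h1]
  rw [list_prod_tmul, prod_sortedRoots hR fun a => ((-1 : ℂ) ^ i a) • c a ^ i a, pbwMonomial,
    Finset.prod_smul, Finset.prod_pow_eq_pow_sum, TensorProduct.tmul_smul, TensorProduct.smul_tmul']

variable [Algebra ℚ S]

/-- The inverse factorials are those of the exponential series, and the global sign goes into the
minus sign of each exponent. Nilpotency makes the sum finite. -/
theorem sum_tmul_pbwMonomial (c : PosRoot r → S) (F : PosRoot r → SL r) {n : ℕ}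
    (hn : ∀ a, c a ^ n = 0) :
    ∑ i ∈ Fintype.piFinset fun _ : PosRoot r => Finset.range n,
        (∏ a, c a ^ i a) ⊗ₜ[ℂ] pbwMonomial R hR F i =
      orderedProd hR Finset.univ fun a =>
        IsNilpotent.exp (-(c a ⊗ₜ[ℂ] UniversalEnvelopingAlgebra.ι ℂ (F a))) := by
  have h1 : ∀ a, IsNilpotent.exp (-(c a ⊗ₜ[ℂ] UniversalEnvelopingAlgebra.ι ℂ (F a))) =
      ∑ k ∈ Finset.range n, (k.factorial : ℂ)⁻¹ •
        (-(c a ⊗ₜ[ℂ] UniversalEnvelopingAlgebra.ι ℂ (F a))) ^ k := by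
    intro a
    rw [IsNilpotent.exp_eq_sum (k := n)]
    · refine Finset.sum_congr rfl fun k _ => ?_
      rw [← Rat.cast_smul_eq_qsmul ℂ]
      push_cast
      rfl
    · rw [neg_pow, Algebra.TensorProduct.tmul_pow, hn, TensorProduct.zero_tmul, mul_zero]
  simp only [h1]
  rw [orderedProd_univ, list_prod_map_sum (sortedRoots_nodup hR) (mem_sortedRoots hR)]
  exact Finset.sum_congr rfl fun i _ => tmul_pbwMonomial hR c F i

theorem sum_tmul_stdF (y : PosRoot r → S) {n : ℕ} (hn : ∀ a, y a ^ n = 0) :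
    ∑ i ∈ Fintype.piFinset fun _ : PosRoot r => Finset.range n, (∏ a, y a ^ i a) ⊗ₜ[ℂ] stdF i =
      orderedProd (stdSucc_isLinear r) Finset.univ fun a => IsNilpotent.exp (rootTerm y a) :=
  sum_tmul_pbwMonomial _ y lowering hn

/-- Each coefficient and its root vector carry the same sign, and the two signs cancel in the tensor
product. -/
theorem sum_tmul_specialF (h : Fin r) (y : PosRoot r → S) {n : ℕ} (hn : ∀ a, y a ^ n = 0) :
    ∑ i ∈ Fintype.piFinset fun _ : PosRoot r => Finset.range n,
        (∏ a, (((-1 : ℂ) ^ reversals h a) • y a) ^ i a) ⊗ₜ[ℂ] specialF h i =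
      orderedProd (succ_isLinear h) Finset.univ fun a => IsNilpotent.exp (rootTerm y a) := by
  unfold specialF
  rw [sum_tmul_pbwMonomial _ _ _ fun a => by rw [smul_pow, hn, smul_zero]]
  congr 1
  funext a
  rw [rootTerm, rootF, map_smul, TensorProduct.smul_tmul_smul, ← mul_pow]
  simp

end Expansion

/-! ### Counting reversals -/

section Reversals

variable {r : ℕ}

/-- The three values are the exponents of -1 in the three cases of `slotPhiAt`. Splitting α_{k,l} at
q is a reversal exactly when h < q and h < l. -/
theorem reversals_eq (h : Fin r) (a : PosRoot r) :
    reversals h a =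
      if (a.1.1 : ℕ) ≤ h ∧ (h : ℕ) < a.1.2 then (a.1.2 : ℕ) - 1 - h
      else if (a.1.2 : ℕ) ≤ h then 0 else (a.1.2 : ℕ) - 1 - a.1.1 := by
  have ha := a.2
  have key : ∀ q : Fin (r + 1), (∃ (h₁ : a.1.1 < q) (h₂ : q < a.1.2),
      Succ h ⟨(a.1.1, q), h₁⟩ ⟨(q, a.1.2), h₂⟩) ↔
      max (h : ℕ) a.1.1 < q ∧ (q : ℕ) < a.1.2 ∧ (h : ℕ) < a.1.2 := by
    intro q
    simp only [Succ, StdSucc, InA, InB, InC, Fin.le_def, Fin.lt_def, Fin.ext_iff,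
      Fin.val_castSucc, exists_prop] at *
    omega
  unfold reversals
  simp only [key]
  split_ifs with h1 h2
  · rw [show (Finset.univ.filter fun q : Fin (r + 1) =>
        max (h : ℕ) a.1.1 < q ∧ (q : ℕ) < a.1.2 ∧ (h : ℕ) < a.1.2) =
        Finset.Ioo h.castSucc a.1.2 by
      ext q
      simp only [Finset.mem_filter, Finset.mem_univ, true_and, Finset.mem_Ioo, Fin.lt_def,
        Fin.val_castSucc]
      omega, Fin.card_Ioo, Fin.val_castSucc]
    omega
  · rw [Finset.card_eq_zero, Finset.filter_eq_empty_iff]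
    intro q _
    omega
  · rw [show (Finset.univ.filter fun q : Fin (r + 1) =>
        max (h : ℕ) a.1.1 < q ∧ (q : ℕ) < a.1.2 ∧ (h : ℕ) < a.1.2) =
        Finset.Ioo a.1.1 a.1.2 by
      ext q
      simp only [Finset.mem_filter, Finset.mem_univ, true_and, Finset.mem_Ioo, Fin.lt_def]
      omega, Fin.card_Ioo]
    omega

end Reversals
-- The algebra of square-zero variables
section SquareZero

/-- The polynomial algebra in variables with zero squares. -/
abbrev SqZero (T : Type*) : Type _ :=
  MvPolynomial T ℂ ⧸ Ideal.span (Set.range fun a : T => (MvPolynomial.X a : MvPolynomial T ℂ) ^ 2)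

namespace SqZero

variable {T : Type*}

/-- The generators. -/
noncomputable def gen (a : T) : SqZero T := Ideal.Quotient.mk _ (MvPolynomial.X a)

theorem gen_sq (a : T) : gen a ^ 2 = 0 := by
  rw [gen, ← map_pow]
  exact Ideal.Quotient.eq_zero_iff_mem.2 (Ideal.subset_span ⟨a, rfl⟩)

theorem isNilpotent_gen (a : T) : IsNilpotent (gen a) := ⟨2, gen_sq a⟩

variable [Fintype T]

/-- The exponent of the product of all variables. -/
noncomputable def topExponent (T : Type*) [Fintype T] : T →₀ ℕ := ∑ a : T, Finsupp.single a 1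

theorem topExponent_apply (a : T) : topExponent T a = 1 := by
  classical
  simp [topExponent, Finsupp.finsetSum_apply, Finsupp.single_apply]

/-- The ideal is monomial, and no square of a variable divides the squarefree product of all
variables. This makes `topCoeff` well defined on the quotient. -/
theorem coeff_topExponent_eq_zero {P : MvPolynomial T ℂ}
    (hP : P ∈ Ideal.span (Set.range fun a : T => (MvPolynomial.X a : MvPolynomial T ℂ) ^ 2)) :
    P.coeff (topExponent T) = 0 := by
  have h : (Set.range fun a : T => (MvPolynomial.X a : MvPolynomial T ℂ) ^ 2) =
      (fun s => MvPolynomial.monomial s (1 : ℂ)) '' Set.range fun a : T => Finsupp.single a 2 := by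
    rw [← Set.range_comp]
    congr 1
    funext a
    simp [MvPolynomial.X_pow_eq_monomial]
  rw [h, MvPolynomial.mem_ideal_span_monomial_image] at hP
  by_contra hne
  obtain ⟨_, ⟨a, rfl⟩, ha⟩ := hP _ (MvPolynomial.mem_support_iff.2 hne)
  have := ha a
  rw [topExponent_apply] at this
  simp at this

/-- The coefficient of the product of all generators. -/
noncomputable def topCoeff (T : Type*) [Fintype T] : SqZero T →ₗ[ℂ] ℂ where
  toFun x := Quotient.liftOn' x (fun P => P.coeff (topExponent T)) fun P Q h => by
    rw [Submodule.quotientRel_def] at h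
    rw [← sub_eq_zero, ← MvPolynomial.coeff_sub]
    exact coeff_topExponent_eq_zero h
  map_add' := by
    rintro ⟨P⟩ ⟨Q⟩
    exact MvPolynomial.coeff_add _ P Q
  map_smul' := by
    rintro c ⟨P⟩
    exact MvPolynomial.coeff_smul _ c P

open Classical in
theorem topCoeff_prod_gen {ι : Type*} [Fintype ι] (g : ι → T) :
    topCoeff T (∏ i, gen (g i)) = if Function.Bijective g then 1 else 0 := by
  have h1 : (∏ i, gen (g i)) = Ideal.Quotient.mk _
      (MvPolynomial.monomial (∑ i, Finsupp.single (g i) 1) (1 : ℂ)) := by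
    rw [MvPolynomial.monomial_sum_one, map_prod]
    rfl
  have h2 : topCoeff T (∏ i, gen (g i)) =
      (MvPolynomial.monomial (∑ i, Finsupp.single (g i) 1) (1 : ℂ)).coeff (topExponent T) := by
    rw [h1]
    rfl
  rw [h2, MvPolynomial.coeff_monomial]
  congr 1
  rw [eq_iff_iff, DFunLike.ext_iff, Function.bijective_iff_existsUnique]
  refine forall_congr' fun a => ?_
  rw [topExponent_apply, Finsupp.finsetSum_apply]
  simp only [Finsupp.single_apply, Finset.sum_boole, Nat.cast_id]
  rw [Finset.card_eq_one]
  refine exists_congr fun b => ?_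
  rw [Finset.eq_singleton_iff_unique_mem]
  simp

end SqZero
end SquareZero
-- Rational functions of roots and their partial fraction relation
section RootElements

variable {r : ℕ} {m : Fin r → ℕ}

/-- The colors `k, …, l - 1` of the root `α_{k,l}`. -/
abbrev RootCol (a : PosRoot r) : Type := {h : Fin r // (a.1.1 : ℕ) ≤ h ∧ (h : ℕ) < a.1.2}

/-- The variable of color `h` selected by `d` (and `0` for other `h`). -/
def colVar (t : Coord m → ℂ) (a : PosRoot r) (d : ∀ h : RootCol a, Fin (m h.1)) (h : ℕ) : ℂ :=
  if hs : (a.1.1 : ℕ) ≤ h ∧ h < a.1.2 then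
    t ⟨⟨h, by have := a.1.2.isLt; omega⟩, d ⟨⟨h, by have := a.1.2.isLt; omega⟩, hs⟩⟩
  else 0

/-- The rational function of the root `α_{k,l}` attached to `z` at the color `c`. -/
noncomputable def rootFun (t : Coord m → ℂ) (z : ℂ) (c : ℕ) (a : PosRoot r)
    (d : ∀ h : RootCol a, Fin (m h.1)) : ℂ :=
  (∏ h ∈ Finset.Ico (a.1.1 : ℕ) (a.1.2 - 1), 1 / (colVar t a d h - colVar t a d (h + 1))) *
    (1 / (colVar t a d c - z))

/-- The sum of the values of `rootFun`, recorded with the variables which they use. -/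
noncomputable def rootElt (t : Coord m → ℂ) (z : ℂ) (c : ℕ) (a : PosRoot r) : SqZero (Coord m) :=
  ∑ d : ∀ h : RootCol a, Fin (m h.1),
    rootFun t z c a d • ∏ h : RootCol a, SqZero.gen (⟨h.1, d h⟩ : Coord m)

theorem isNilpotent_rootElt (t : Coord m → ℂ) (z : ℂ) (c : ℕ) (a : PosRoot r) :
    IsNilpotent (rootElt t z c a) := by
  refine isNilpotent_sum fun d _ => IsNilpotent.smul ?_ _
  have ha := a.2
  have hr := a.1.2.isLt
  -- Since k < l the root has at least the colour k, so every term contains a variable of square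
  -- zero.
  let h₀ : RootCol a := ⟨⟨a.1.1, by omega⟩, le_rfl, ha⟩
  rw [← Finset.mul_prod_erase _ _ (Finset.mem_univ h₀)]
  exact (Commute.all _ _).isNilpotent_mul_right (SqZero.isNilpotent_gen _)

/-- A choice of variables for a root is a pair of choices for two roots of which it is the sum. -/
def splitChoice {a b c : PosRoot r} {q : ℕ} (ha : (a.1.2 : ℕ) = q) (hb : (b.1.1 : ℕ) = q)
    (hca : c.1.1 = a.1.1) (hcb : c.1.2 = b.1.2) :
    (∀ h : RootCol c, Fin (m h.1)) ≃
      (∀ h : RootCol b, Fin (m h.1)) × ∀ h : RootCol a, Fin (m h.1) where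
  toFun d := (fun h => d ⟨h.1, by have := h.2; have := a.2; omega⟩,
    fun h => d ⟨h.1, by have := h.2; have := b.2; omega⟩)
  invFun x h := if hq : (h.1 : ℕ) < q then x.2 ⟨h.1, by have := h.2; omega⟩
    else x.1 ⟨h.1, by have := h.2; omega⟩
  left_inv d := by
    funext h
    dsimp only
    split_ifs <;> rfl
  right_inv x := by
    refine Prod.ext (funext fun h => ?_) (funext fun h => ?_)
    · have := h.2
      dsimp only
      rw [dif_neg (by omega)]
    · have := h.2
      dsimp only
      rw [dif_pos (by omega)]

/-- The colors of a sum of two roots. -/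
noncomputable def splitCol {a b c : PosRoot r} {q : ℕ} (ha : (a.1.2 : ℕ) = q)
    (hb : (b.1.1 : ℕ) = q) (hca : c.1.1 = a.1.1) (hcb : c.1.2 = b.1.2) :
    RootCol b ⊕ RootCol a ≃ RootCol c :=
  Equiv.ofBijective
    (Sum.elim (fun h => ⟨h.1, by have := h.2; have := a.2; omega⟩)
      fun h => ⟨h.1, by have := h.2; have := b.2; omega⟩) <| by
    constructor
    · rintro (⟨x, hx⟩ | ⟨x, hx⟩) (⟨y, hy⟩ | ⟨y, hy⟩) h <;>
        simp only [Sum.elim_inl, Sum.elim_inr, Subtype.mk.injEq] at h <;> subst h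
      · rfl
      · omega
      · omega
      · rfl
    · rintro ⟨x, hx⟩
      by_cases hq : (x : ℕ) < q
      · exact ⟨.inr ⟨x, by omega⟩, rfl⟩
      · exact ⟨.inl ⟨x, by omega⟩, rfl⟩

/-- With x, y the variables of colours q and q + 1, this is (1/(x - y)) (1/(y - z) - 1/(x - z)) =
1/((x - z)(y - z)). The link 1/(x - y) is the one lost when the chain of c is cut into those of a
and b. -/
theorem rootFun_sub {a b c : PosRoot r} {q : ℕ} (ha : (a.1.2 : ℕ) = q + 1)
    (hb : (b.1.1 : ℕ) = q + 1) (hca : c.1.1 = a.1.1) (hcb : c.1.2 = b.1.2) {t : Coord m → ℂ}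
    {z : ℂ} (hz : ∀ x, t x ≠ z) (ht : ∀ x y : Coord m, (x.1 : ℕ) + 1 = y.1 → t x ≠ t y)
    (d : ∀ h : RootCol c, Fin (m h.1)) :
    rootFun t z (q + 1) c d - rootFun t z q c d =
      rootFun t z (q + 1) b (splitChoice ha hb hca hcb d).1 *
        rootFun t z q a (splitChoice ha hb hca hcb d).2 := by
  have ha' := a.2
  have hb' := b.2
  have hr := b.1.2.isLt
  have e1 : ∀ h, q + 1 ≤ h → h < b.1.2 →
      colVar t b (splitChoice ha hb hca hcb d).1 h = colVar t c d h := by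
    intro h h1 h2
    unfold colVar
    rw [dif_pos (by omega), dif_pos (by omega)]
    rfl
  have e2 : ∀ h : ℕ, a.1.1 ≤ h → h < q + 1 →
      colVar t a (splitChoice ha hb hca hcb d).2 h = colVar t c d h := by
    intro h h1 h2
    unfold colVar
    rw [dif_pos (by omega), dif_pos (by omega)]
    rfl
  have p1 : ∏ h ∈ Finset.Ico (b.1.1 : ℕ) (b.1.2 - 1),
      1 / (colVar t b (splitChoice ha hb hca hcb d).1 h -
        colVar t b (splitChoice ha hb hca hcb d).1 (h + 1)) =
      ∏ h ∈ Finset.Ico (q + 1) (c.1.2 - 1), 1 / (colVar t c d h - colVar t c d (h + 1)) := by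
    refine Finset.prod_congr (by rw [hb, hcb]) fun h hh => ?_
    rw [Finset.mem_Ico] at hh
    rw [e1 h (by omega) (by omega), e1 (h + 1) (by omega) (by omega)]
  have p2 : ∏ h ∈ Finset.Ico (a.1.1 : ℕ) (a.1.2 - 1),
      1 / (colVar t a (splitChoice ha hb hca hcb d).2 h -
        colVar t a (splitChoice ha hb hca hcb d).2 (h + 1)) =
      ∏ h ∈ Finset.Ico (c.1.1 : ℕ) q, 1 / (colVar t c d h - colVar t c d (h + 1)) := by
    refine Finset.prod_congr (by rw [ha, hca, Nat.add_sub_cancel]) fun h hh => ?_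
    rw [Finset.mem_Ico] at hh
    rw [e2 h (by omega) (by omega), e2 (h + 1) (by omega) (by omega)]
  have hx : colVar t c d q = t ⟨⟨q, by omega⟩, d ⟨⟨q, by omega⟩, by simp only; omega⟩⟩ :=
    dif_pos (by omega)
  have hy : colVar t c d (q + 1) =
      t ⟨⟨q + 1, by omega⟩, d ⟨⟨q + 1, by omega⟩, by simp only; omega⟩⟩ := dif_pos (by omega)
  have h1 : colVar t c d q - z ≠ 0 := sub_ne_zero.2 (hx ▸ hz _)
  have h2 : colVar t c d (q + 1) - z ≠ 0 := sub_ne_zero.2 (hy ▸ hz _)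
  have h3 : colVar t c d q - colVar t c d (q + 1) ≠ 0 := by
    rw [hx, hy]
    exact sub_ne_zero.2 (ht _ _ rfl)
  unfold rootFun
  rw [p1, p2, e1 _ le_rfl (by omega), e2 _ (by omega) (by omega),
    ← Finset.prod_Ico_consecutive _ (show (c.1.1 : ℕ) ≤ q + 1 by omega)
      (show q + 1 ≤ (c.1.2 : ℕ) - 1 by omega),
    Finset.prod_Ico_succ_top (show (c.1.1 : ℕ) ≤ q by omega)]
  generalize colVar t c d q = x at *
  generalize colVar t c d (q + 1) = y at *
  field_simp
  ring

/-- The colours of c are the disjoint union of those of a and b, so both the choices of coordinates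
and the products of variables factor. -/
theorem rootElt_sub {a b c : PosRoot r} {q : ℕ} (ha : (a.1.2 : ℕ) = q + 1)
    (hb : (b.1.1 : ℕ) = q + 1) (hca : c.1.1 = a.1.1) (hcb : c.1.2 = b.1.2) {t : Coord m → ℂ}
    {z : ℂ} (hz : ∀ x, t x ≠ z) (ht : ∀ x y : Coord m, (x.1 : ℕ) + 1 = y.1 → t x ≠ t y) :
    rootElt t z (q + 1) c - rootElt t z q c = rootElt t z (q + 1) b * rootElt t z q a := by
  unfold rootElt
  rw [Finset.sum_mul_sum, ← Finset.sum_sub_distrib, ← Fintype.sum_prod_type']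
  refine Fintype.sum_equiv (splitChoice ha hb hca hcb) _ _ fun d => ?_
  rw [← sub_smul, rootFun_sub ha hb hca hcb hz ht, smul_mul_smul_comm]
  congr 1
  rw [← Fintype.prod_equiv (splitCol ha hb hca hcb) (Sum.elim
    (fun h => SqZero.gen (⟨h.1, (splitChoice ha hb hca hcb d).1 h⟩ : Coord m))
    fun h => SqZero.gen (⟨h.1, (splitChoice ha hb hca hcb d).2 h⟩ : Coord m)),
    Fintype.prod_sum_type]
  · rfl
  · rintro (h | h) <;> rfl

/-- The color of `α_{k,l}` that is closest to `h`. -/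
def attachAt (h : ℕ) (a : PosRoot r) : ℕ := max a.1.1 (min h (a.1.2 - 1))

theorem orderedProd_rootElt {t : Coord m → ℂ} {z : ℂ} (hz : ∀ x, t x ≠ z)
    (ht : ∀ x y : Coord m, (x.1 : ℕ) + 1 = y.1 → t x ≠ t y) (h : Fin r) :
    orderedProd (succ_isLinear h) Finset.univ (fun a => IsNilpotent.exp
        (rootTerm (fun a => rootElt t z (attachAt h a) a) a)) =
      orderedProd (stdSucc_isLinear r) Finset.univ (fun a => IsNilpotent.exp
        (rootTerm (fun a => rootElt t z (a.1.2 - 1) a) a)) := by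
  refine orderedProd_succ_eq_std (fun (h : Fin r) a => rootElt t z (attachAt h a) a)
    (fun a => rootElt t z (a.1.2 - 1) a) (fun _ _ => isNilpotent_rootElt _ _ _ _)
    (fun h h' hh a ha => ?_) (fun h h' hh a b c ha hb hca hcb => ?_) (fun h hh => ?_) h
  · have := a.2
    have e : attachAt h' a = attachAt h a := by
      unfold attachAt
      omega
    simp only [e]
  · have := a.2
    have := b.2
    have e1 : attachAt h' c = h + 1 := by
      unfold attachAt
      omega
    have e2 : attachAt h c = h := by
      unfold attachAt
      omega
    have e3 : attachAt h' b = h + 1 := by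
      unfold attachAt
      omega
    have e4 : attachAt h' a = h := by
      unfold attachAt
      omega
    simp only [e1, e2, e3, e4]
    exact rootElt_sub (ha.trans hh.symm) (hb.trans hh.symm) hca hcb hz ht
  · funext a
    have := a.2
    have := a.1.2.isLt
    have e : attachAt h a = a.1.2 - 1 := by
      unfold attachAt
      omega
    simp only [e]

end RootElements
-- Symmetrized rational functions as top coefficients
section SlotExpansion

variable {r p : ℕ} {m : Fin r → ℕ}

/-- The coordinates used by a choice of variables for all slots. -/
def slotMap {J : Fin p → PosRoot r → ℕ} (D : ∀ s : Slots J, ∀ h : RootCol s.2.1, Fin (m h.1))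
    (x : Σ s : Slots J, RootCol s.2.1) : Coord m := ⟨x.2.1, D x.1 x.2⟩

open Classical in
theorem topCoeff_prod_rootElt (J : Fin p → PosRoot r → ℕ) (t : Coord m → ℂ) (z : Fin p → ℂ)
    (c : PosRoot r → ℕ) :
    SqZero.topCoeff (Coord m) (∏ s : Slots J, rootElt t (z s.1) (c s.2.1) s.2.1) =
      ∑ D : ∀ s : Slots J, ∀ h : RootCol s.2.1, Fin (m h.1),
        if Function.Bijective (slotMap D) then
          ∏ s : Slots J, rootFun t (z s.1) (c s.2.1) s.2.1 (D s) else 0 := by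
  unfold rootElt
  rw [Finset.prod_univ_sum, map_sum, Fintype.piFinset_univ]
  refine Finset.sum_congr rfl fun D _ => ?_
  rw [Finset.prod_smul, map_smul, ← Fintype.prod_sigma'
    (fun (s : Slots J) (h : RootCol s.2.1) => SqZero.gen (⟨h.1, D s h⟩ : Coord m))]
  have h := SqZero.topCoeff_prod_gen (slotMap D)
  unfold slotMap at h ⊢
  rw [h, smul_eq_mul, mul_ite, mul_one, mul_zero]
  split_ifs <;> rfl

/-- The choice of variables at the color `h`. -/
def slotFiber {J : Fin p → PosRoot r → ℕ} (D : ∀ s : Slots J, ∀ h : RootCol s.2.1, Fin (m h.1))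
    (h : Fin r) (s : SlotsAt J h) : Fin (m h) := D s.1 ⟨h, s.2⟩

theorem bijective_slotMap_iff {J : Fin p → PosRoot r → ℕ}
    (D : ∀ s : Slots J, ∀ h : RootCol s.2.1, Fin (m h.1)) :
    Function.Bijective (slotMap D) ↔ ∀ h, Function.Bijective (slotFiber D h) := by
  constructor
  · intro H h
    constructor
    · rintro ⟨s, hs⟩ ⟨s', hs'⟩ e
      have := @H.1 ⟨s, ⟨h, hs⟩⟩ ⟨s', ⟨h, hs'⟩⟩ (Sigma.ext rfl (heq_of_eq e))
      exact Subtype.ext (congrArg Sigma.fst this)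
    · intro d
      obtain ⟨⟨s, ⟨h', hs⟩⟩, e⟩ := H.2 ⟨h, d⟩
      obtain rfl : h' = h := congrArg Sigma.fst e
      exact ⟨⟨s, hs⟩, eq_of_heq (Sigma.mk.inj e).2⟩
  · intro H
    constructor
    · rintro ⟨s, ⟨h, hs⟩⟩ ⟨s', ⟨h', hs'⟩⟩ e
      obtain rfl : h = h' := congrArg Sigma.fst e
      have := @(H h).1 ⟨s, hs⟩ ⟨s', hs'⟩ (eq_of_heq (Sigma.mk.inj e).2)
      obtain rfl : s = s' := congrArg Subtype.val this
      rfl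
    · rintro ⟨h, d⟩
      obtain ⟨⟨s, hs⟩, e⟩ := (H h).2 d
      exact ⟨⟨s, ⟨h, hs⟩⟩, Sigma.ext rfl (heq_of_eq e)⟩

theorem card_slotsAt (J : Fin p → PosRoot r → ℕ) (h : Fin r) :
    Fintype.card (SlotsAt J h) =
      ∑ j, ∑ a : PosRoot r, if a.1.1 ≤ h.castSucc ∧ h.castSucc < a.1.2 then J j a else 0 := by
  rw [Fintype.card_subtype, Finset.card_filter, Fintype.sum_sigma]
  refine Finset.sum_congr rfl fun j _ => ?_
  rw [Fintype.sum_sigma]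
  refine Finset.sum_congr rfl fun a _ => ?_
  simp only [Fin.le_def, Fin.lt_def, Fin.val_castSucc]
  split_ifs <;> simp

/-- A choice using every coordinate once forces exactly m_h slots of each colour h, which is the
condition defining the index set. -/
theorem topCoeff_prod_rootElt_of_notMem {J : Fin p → PosRoot r → ℕ} (hJ : J ∉ indexSet m p)
    (t : Coord m → ℂ) (z : Fin p → ℂ) (c : PosRoot r → ℕ) :
    SqZero.topCoeff (Coord m) (∏ s : Slots J, rootElt t (z s.1) (c s.2.1) s.2.1) = 0 := by
  rw [topCoeff_prod_rootElt]
  refine Finset.sum_eq_zero fun D _ => if_neg fun H => hJ ?_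
  rw [mem_indexSet]
  intro h
  rw [← card_slotsAt, Fintype.card_of_bijective ((bijective_slotMap_iff D).1 H h),
    Fintype.card_fin]

/-- The choices that use each coordinate once are families of bijections from the slots of colour h
to its coordinates. Each such family is β followed by a unique σ. -/
theorem topCoeff_prod_rootElt_of_mem (β : Bijections m p) (I : indexSet m p)
    (t : Coord m → ℂ) (z : Fin p → ℂ) (c : PosRoot r → ℕ) :
    SqZero.topCoeff (Coord m) (∏ s : Slots I.1, rootElt t (z s.1) (c s.2.1) s.2.1) =
      ∑ σ : ∀ k, Equiv.Perm (Fin (m k)), ∏ s : Slots I.1,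
        rootFun (permute σ t) (z s.1) (c s.2.1) s.2.1 fun h => β I h.1 ⟨s, h.2⟩ := by
  classical
  rw [topCoeff_prod_rootElt, ← Finset.sum_filter]
  symm
  refine Finset.sum_bij (fun σ _ s h => σ h.1 (β I h.1 ⟨s, h.2⟩)) ?_ ?_ ?_ ?_
  · intro σ _
    rw [Finset.mem_filter, bijective_slotMap_iff]
    exact ⟨Finset.mem_univ _, fun h => ((β I h).trans (σ h)).bijective⟩
  · intro σ _ σ' _ e
    funext k
    ext1 d
    have := congrFun (congrFun e ((β I k).symm d).1) ⟨k, ((β I k).symm d).2⟩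
    simpa using this
  · intro D hD
    rw [Finset.mem_filter, bijective_slotMap_iff] at hD
    refine ⟨fun k => (β I k).symm.trans (Equiv.ofBijective _ (hD.2 k)), Finset.mem_univ _, ?_⟩
    funext s h
    simp [slotFiber]
  · intro σ _
    refine Finset.prod_congr rfl fun s _ => ?_
    rfl

theorem slotPhi_eq_rootFun (β : Bijections m p) (I : indexSet m p) (z : Fin p → ℂ)
    (t : Coord m → ℂ) (s : Slots I.1) :
    slotPhi β I z t s =
      rootFun t (z s.1) (s.2.1.1.2 - 1) s.2.1 fun h => β I h.1 ⟨s, h.2⟩ := rfl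

theorem slotPhiAt_eq_rootFun (β : Bijections m p) (I : indexSet m p) (h : Fin r) (z : Fin p → ℂ)
    (t : Coord m → ℂ) (s : Slots I.1) :
    slotPhiAt β I h z t s = (-1) ^ reversals h s.2.1 *
      rootFun t (z s.1) (attachAt h s.2.1) s.2.1 fun h => β I h.1 ⟨s, h.2⟩ := by
  have hs := s.2.1.2
  have key : ∀ n q : ℕ, n = reversals h s.2.1 → q = attachAt h s.2.1 →
      slotChain β I t s * ((-1) ^ n / (slotVar β I t s q - z s.1)) =
      (-1) ^ reversals h s.2.1 *
        rootFun t (z s.1) (attachAt h s.2.1) s.2.1 fun h => β I h.1 ⟨s, h.2⟩ := by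
    rintro n q rfl rfl
    change _ = _ * (slotChain β I t s * (1 / (slotVar β I t s _ - z s.1)))
    ring
  have hrev := reversals_eq h s.2.1
  unfold slotPhiAt
  split_ifs at hrev ⊢ with h1 h2
  · refine key _ _ hrev.symm ?_
    unfold attachAt
    omega
  -- For l ≤ h there are no reversals; the numerator 1 becomes a zeroth power to fit `key`.
  · rw [← pow_zero (-1 : ℂ)]
    refine key _ _ hrev.symm ?_
    unfold attachAt
    omega
  · refine key _ _ hrev.symm ?_
    unfold attachAt
    omega

theorem prod_slots {M : Type*} [CommMonoid M] (J : Fin p → PosRoot r → ℕ)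
    (f : Fin p → PosRoot r → M) :
    ∏ s : Slots J, f s.1 s.2.1 = ∏ j, ∏ a, f j a ^ J j a := by
  rw [Fintype.prod_sigma]
  refine Finset.prod_congr rfl fun j _ => ?_
  rw [Fintype.prod_sigma]
  refine Finset.prod_congr rfl fun a _ => ?_
  simp

theorem sum_phi_permute (β : Bijections m p) (I : indexSet m p) (z : Fin p → ℂ)
    (t : Coord m → ℂ) :
    ∑ σ, phi β I z (permute σ t) = SqZero.topCoeff (Coord m)
      (∏ j, ∏ a : PosRoot r, rootElt t (z j) (a.1.2 - 1) a ^ I.1 j a) := by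
  rw [← prod_slots I.1 fun j a => rootElt t (z j) (a.1.2 - 1) a,
    topCoeff_prod_rootElt_of_mem β I t z fun a => a.1.2 - 1]
  rfl

theorem sum_phiAt_permute (β : Bijections m p) (I : indexSet m p) (h : Fin r) (z : Fin p → ℂ)
    (t : Coord m → ℂ) :
    ∑ σ, phiAt β I h z (permute σ t) = SqZero.topCoeff (Coord m)
      (∏ j, ∏ a : PosRoot r,
        (((-1 : ℂ) ^ reversals h a) • rootElt t (z j) (attachAt h a) a) ^ I.1 j a) := by
  rw [← prod_slots I.1 fun j a => ((-1 : ℂ) ^ reversals h a) • rootElt t (z j) (attachAt h a) a,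
    Finset.prod_smul, map_smul, topCoeff_prod_rootElt_of_mem β I t z (attachAt h), smul_eq_mul,
    Finset.mul_sum]
  refine Finset.sum_congr rfl fun σ _ => ?_
  rw [← Finset.prod_mul_distrib]
  exact Finset.prod_congr rfl fun s _ => slotPhiAt_eq_rootFun β I h z _ s

end SlotExpansion
-- Separation of the tensor factors and the pointwise identity
section TensorFactors

theorem list_prod_map_mulSingle {ι : Type*} [DecidableEq ι] {A : ι → Type*} [∀ i, Monoid (A i)]
    (u : ∀ i, A i) (l : List ι) (hl : l.Nodup) (i : ι) :
    (l.map fun j => Pi.mulSingle j (u j)).prod i = if i ∈ l then u i else 1 := by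
  induction l with
  | nil => simp
  | cons j l ih =>
    rw [List.nodup_cons] at hl
    rw [List.map_cons, List.prod_cons, Pi.mul_apply, ih hl.2]
    by_cases hij : i = j
    · subst hij
      simp [hl.1]
    · simp [hij]

variable {p : ℕ} {S A : Type*} [CommRing S] [Algebra ℂ S] [Ring A] [Algebra ℂ A]

/-- The product of elements of `S ⊗ A`, one for each tensor factor, in `S ⊗ A^{⊗p}`. -/
noncomputable def tensorPower (p : ℕ) (S A : Type*) [CommRing S] [Algebra ℂ S] [Ring A]
    [Algebra ℂ A] :
    MultilinearMap ℂ (fun _ : Fin p => S ⊗[ℂ] A) (S ⊗[ℂ] PiTensorProduct ℂ fun _ : Fin p => A) :=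
  (MultilinearMap.mkPiAlgebraFin ℂ p _).compLinearMap fun j =>
    (Algebra.TensorProduct.map (AlgHom.id ℂ S)
      (PiTensorProduct.singleAlgHom (R := ℂ) (A := fun _ : Fin p => A) j)).toLinearMap

theorem tensorPower_tmul (c : Fin p → S) (u : Fin p → A) :
    tensorPower p S A (fun j => c j ⊗ₜ[ℂ] u j) = (∏ j, c j) ⊗ₜ[ℂ] PiTensorProduct.tprod ℂ u := by
  have h1 : ((List.finRange p).map fun j =>
      PiTensorProduct.singleAlgHom (R := ℂ) (A := fun _ : Fin p => A) j (u j)).prod =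
      PiTensorProduct.tprod ℂ u := by
    change ((List.finRange p).map fun j =>
      PiTensorProduct.tprodMonoidHom ℂ (A := fun _ : Fin p => A) (Pi.mulSingle j (u j))).prod = _
    have h := map_list_prod (PiTensorProduct.tprodMonoidHom ℂ (A := fun _ : Fin p => A))
      ((List.finRange p).map fun j => Pi.mulSingle j (u j))
    rw [List.map_map] at h
    refine h.symm.trans (congrArg (PiTensorProduct.tprod ℂ) ?_)
    funext i
    rw [list_prod_map_mulSingle _ _ (List.nodup_finRange p), if_pos (List.mem_finRange i)]
  unfold tensorPower
  simp only [MultilinearMap.compLinearMap_apply, MultilinearMap.mkPiAlgebraFin_apply,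
    AlgHom.toLinearMap_apply, Algebra.TensorProduct.map_tmul, AlgHom.id_apply]
  rw [List.ofFn_eq_map, list_prod_tmul, h1, ← List.ofFn_eq_map, List.prod_ofFn]

variable {r : ℕ} {m : Fin r → ℕ} {V : Fin p → Type*} [∀ j, AddCommGroup (V j)]
  [∀ j, Module ℂ (V j)] [∀ j, LieRingModule (SL r) (V j)] [∀ j, LieModule ℂ (SL r) (V j)]

/-- The action of `U(sl_N)` on a vector, as a linear map. -/
noncomputable def actOn {W : Type*} [AddCommGroup W] [Module ℂ W] [LieRingModule (SL r) W]
    [LieModule ℂ (SL r) W] (w : W) : UniversalEnvelopingAlgebra ℂ (SL r) →ₗ[ℂ] W :=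
  (UniversalEnvelopingAlgebra.lift ℂ (LieModule.toEnd ℂ (SL r) W)).toLinearMap.flip w

theorem actOn_apply {W : Type*} [AddCommGroup W] [Module ℂ W] [LieRingModule (SL r) W]
    [LieModule ℂ (SL r) W] (w : W) (x : UniversalEnvelopingAlgebra ℂ (SL r)) :
    actOn w x = act x w := rfl

/-- Apply the elements of `U(sl_N)^{⊗p}` to `v_1 ⊗ ⋯ ⊗ v_p` and take the top coefficient. -/
noncomputable def topAct (m : Fin r → ℕ) (v : ∀ j, V j) :
    SqZero (Coord m) ⊗[ℂ] (PiTensorProduct ℂ fun _ : Fin p => UniversalEnvelopingAlgebra ℂ (SL r))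
      →ₗ[ℂ] PiTensorProduct ℂ V :=
  (TensorProduct.lid ℂ _).toLinearMap ∘ₗ
    TensorProduct.map (SqZero.topCoeff (Coord m)) (PiTensorProduct.map fun j => actOn (v j))

theorem topAct_tmul_tprod (v : ∀ j, V j) (x : SqZero (Coord m))
    (u : Fin p → UniversalEnvelopingAlgebra ℂ (SL r)) :
    topAct m v (x ⊗ₜ[ℂ] PiTensorProduct.tprod ℂ u) =
      SqZero.topCoeff (Coord m) x • PiTensorProduct.tprod ℂ fun j => act (u j) (v j) := by
  simp [topAct, PiTensorProduct.map_tprod, actOn_apply]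

/-- The constraint on I couples the tensor factors. The top coefficient imposes it automatically, so
each I_j may run independently over a box, and the sum becomes the value of a multilinear map on p
separate generating series. -/
theorem sum_indexSet_topCoeff (v : ∀ j, V j) (c : Fin p → (PosRoot r → ℕ) → SqZero (Coord m))
    (F : (PosRoot r → ℕ) → UniversalEnvelopingAlgebra ℂ (SL r)) {n : ℕ} (hn : ∑ k, m k + 1 ≤ n)
    (hc : ∀ J : Fin p → PosRoot r → ℕ, J ∉ indexSet m p →
      SqZero.topCoeff (Coord m) (∏ j, c j (J j)) = 0) :
    ∑ I : indexSet m p, SqZero.topCoeff (Coord m) (∏ j, c j (I.1 j)) •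
        PiTensorProduct.tprod ℂ (fun j => act (F (I.1 j)) (v j)) =
      topAct m v (tensorPower p _ _ fun j =>
        ∑ i ∈ Fintype.piFinset fun _ : PosRoot r => Finset.range n, c j i ⊗ₜ[ℂ] F i) := by
  rw [MultilinearMap.map_sum_finset, map_sum,
    Finset.sum_coe_sort (indexSet m p) fun I => SqZero.topCoeff (Coord m) (∏ j, c j (I j)) •
        PiTensorProduct.tprod ℂ (fun j => act (F (I j)) (v j))]
  simp only [tensorPower_tmul, topAct_tmul_tprod]
  refine Finset.sum_subset (fun I hI => ?_) fun J _ hJ => by rw [hc J hJ, zero_smul]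
  have hI' := (Finset.mem_filter.1 hI).1
  simp only [Fintype.mem_piFinset, Finset.mem_range] at hI' ⊢
  exact fun j a => (hI' j a).trans_le hn

theorem sum_stdForm_permute_eq (v : ∀ j, V j) (β : Bijections m p) (z : Fin p → ℂ)
    (t : Coord m → ℂ) {n : ℕ} (hn : ∑ k, m k + 1 ≤ n) :
    ∑ σ, stdForm v β z (permute σ t) = topAct m v (tensorPower p _ _ fun j =>
      ∑ i ∈ Fintype.piFinset fun _ : PosRoot r => Finset.range n,
        (∏ a, rootElt t (z j) (a.1.2 - 1) a ^ i a) ⊗ₜ[ℂ] stdF i) := by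
  rw [← sum_indexSet_topCoeff v (fun j i => ∏ a, rootElt t (z j) (a.1.2 - 1) a ^ i a) stdF hn]
  · unfold stdForm
    rw [Finset.sum_comm]
    refine Finset.sum_congr rfl fun I _ => ?_
    rw [← Finset.sum_smul, sum_phi_permute]
  · intro J hJ
    rw [← prod_slots J fun j a => rootElt t (z j) (a.1.2 - 1) a]
    exact topCoeff_prod_rootElt_of_notMem hJ t z fun a => a.1.2 - 1

theorem sum_specialForm_permute_eq (v : ∀ j, V j) (β : Bijections m p) (h : Fin r)
    (z : Fin p → ℂ) (t : Coord m → ℂ) {n : ℕ} (hn : ∑ k, m k + 1 ≤ n) :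
    ∑ σ, specialForm v β h z (permute σ t) = topAct m v (tensorPower p _ _ fun j =>
      ∑ i ∈ Fintype.piFinset fun _ : PosRoot r => Finset.range n,
        (∏ a, (((-1 : ℂ) ^ reversals h a) • rootElt t (z j) (attachAt h a) a) ^ i a)
          ⊗ₜ[ℂ] specialF h i) := by
  rw [← sum_indexSet_topCoeff v (fun j i =>
    ∏ a, (((-1 : ℂ) ^ reversals h a) • rootElt t (z j) (attachAt h a) a) ^ i a) (specialF h) hn]
  · unfold specialForm
    rw [Finset.sum_comm]
    refine Finset.sum_congr rfl fun I _ => ?_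
    rw [← Finset.sum_smul, sum_phiAt_permute]
  · intro J hJ
    rw [← prod_slots J fun j a => ((-1 : ℂ) ^ reversals h a) • rootElt t (z j) (attachAt h a) a,
      Finset.prod_smul, map_smul, topCoeff_prod_rootElt_of_notMem hJ t z (attachAt h), smul_zero]

/-- Both symmetrizations are the same functional of p generating series, and these agree factor by
factor by `orderedProd_rootElt`. -/
theorem sum_stdForm_permute (v : ∀ j, V j) (β : Bijections m p) (h : Fin r) {z : Fin p → ℂ}
    {t : Coord m → ℂ} (hz : ∀ x j, t x ≠ z j)
    (ht : ∀ x y : Coord m, (x.1 : ℕ) + 1 = y.1 → t x ≠ t y) :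
    ∑ σ, stdForm v β z (permute σ t) = ∑ σ, specialForm v β h z (permute σ t) := by
  have hnil : ∀ (c : PosRoot r → ℕ), ∃ n, ∀ j a, rootElt t (z j) (c a) a ^ n = 0 := by
    intro c
    choose n hn using fun (j : Fin p) a => isNilpotent_rootElt t (z j) (c a) a
    refine ⟨∑ j, ∑ a, n j a, fun j a => pow_eq_zero_of_le ?_ (hn j a)⟩
    exact (Finset.single_le_sum (f := fun a => n j a) (fun _ _ => Nat.zero_le _)
      (Finset.mem_univ a)).trans (Finset.single_le_sum (f := fun j => ∑ a, n j a)
        (fun _ _ => Nat.zero_le _) (Finset.mem_univ j))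
  -- One box size must serve three purposes: contain the index set, and truncate the exponentials of
  -- both families. Hence the maximum of three bounds.
  obtain ⟨n₁, hn₁⟩ := hnil fun a => a.1.2 - 1
  obtain ⟨n₂, hn₂⟩ := hnil (attachAt h)
  rw [sum_stdForm_permute_eq v β z t (le_max_left _ (max n₁ n₂)),
    sum_specialForm_permute_eq v β h z t (le_max_left _ (max n₁ n₂))]
  refine congrArg (fun x => topAct m v (tensorPower p _ _ x)) (funext fun j => ?_)
  refine (sum_tmul_stdF _ fun a => ?_).trans
    ((orderedProd_rootElt (fun x => hz x j) ht h).symm.trans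
      (sum_tmul_specialF h _ fun a => ?_).symm)
  · exact pow_eq_zero_of_le ((le_max_left _ _).trans (le_max_right _ _)) (hn₁ j a)
  · exact pow_eq_zero_of_le ((le_max_right _ _).trans (le_max_right _ _)) (hn₂ j a)

end TensorFactors
-- Continuity on the simplex in affine coordinates
section Corner

theorem isClosed_corner (d : ℕ) : IsClosed (corner d) := by
  refine (isClosed_stdSimplex ℝ (Fin (d + 1))).preimage (f := fun y : Fin d → ℝ =>
    (Fin.cons (1 - ∑ i, y i) y : Fin (d + 1) → ℝ)) ?_
  exact continuous_pi fun i => by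
    refine Fin.cases ?_ (fun i => ?_) i
    · simp only [Fin.cons_zero]
      fun_prop
    · simp only [Fin.cons_succ]
      fun_prop

theorem mem_corner_iff {d : ℕ} {y : Fin d → ℝ} :
    y ∈ corner d ↔ (∀ i, 0 ≤ y i) ∧ ∑ i, y i ≤ 1 := by
  simp only [corner, stdSimplex, Set.mem_ofPred_eq, Fin.forall_fin_succ, Fin.sum_univ_succ,
    Fin.cons_zero, Fin.cons_succ, sub_nonneg, sub_add_cancel, and_true]
  exact and_comm

theorem isCompact_corner (d : ℕ) : IsCompact (corner d) := by
  refine (isCompact_Icc (a := (0 : Fin d → ℝ)) (b := 1)).of_isClosed_subset (isClosed_corner d) ?_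
  intro y hy
  rw [mem_corner_iff] at hy
  exact ⟨fun i => hy.1 i, fun i =>
    (Finset.single_le_sum (fun j _ => hy.1 j) (Finset.mem_univ i)).trans hy.2⟩

/-- Unique differentiability, up to the boundary, is what makes the derivative within the simplex,
and so the Jacobian, continuous. -/
theorem uniqueDiffOn_corner (d : ℕ) : UniqueDiffOn ℝ (corner d) := by
  refine uniqueDiffOn_convex ?_ ?_
  · intro x hx y hy a b ha hb hab
    rw [mem_corner_iff] at hx hy ⊢
    refine ⟨fun i => ?_, ?_⟩
    · have := hx.1 i
      have := hy.1 i
      simp only [Pi.add_apply, Pi.smul_apply, smul_eq_mul]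
      positivity
    · simp only [Pi.add_apply, Pi.smul_apply, smul_eq_mul, Finset.sum_add_distrib,
        ← Finset.mul_sum]
      nlinarith [hx.2, hy.2]
  · have ho : IsOpen {y : Fin d → ℝ | (∀ i, 0 < y i) ∧ ∑ i, y i < 1} := by
      simp only [Set.ofPred_and, Set.ofPred_forall]
      refine (isOpen_iInter_of_finite fun i => ?_).inter ?_
      · exact isOpen_lt continuous_const (continuous_apply i)
      · exact isOpen_lt (by fun_prop) continuous_const
    -- The barycentre is an interior point.
    refine ⟨fun _ => ((d : ℝ) + 1)⁻¹, interior_maximal (fun y hy => ?_) ho ⟨fun i => ?_, ?_⟩⟩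
    · exact mem_corner_iff.2 ⟨fun i => (hy.1 i).le, hy.2.le⟩
    · positivity
    · simp only [Finset.sum_const, Finset.card_univ, Fintype.card_fin, nsmul_eq_mul]
      rw [← div_eq_mul_inv, div_lt_one (by positivity)]
      linarith

theorem inCoords_of_mem {d : ℕ} {E : Type*} [Zero E] (f : Simplex d → E) {y : Fin d → ℝ}
    (hy : y ∈ corner d) : inCoords f y = f ⟨_, hy⟩ := dif_pos hy

theorem continuousOn_inCoords {d : ℕ} {E : Type*} [Zero E] [TopologicalSpace E]
    {f : Simplex d → E} (hf : Continuous f) : ContinuousOn (inCoords f) (corner d) := by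
  rw [continuousOn_iff_continuous_domRestrict]
  have : (corner d).domRestrict (inCoords f) = fun y : corner d => f ⟨_, y.2⟩ :=
    funext fun y => inCoords_of_mem f y.2
  rw [this]
  refine hf.comp (Continuous.subtype_mk ?_ _)
  exact continuous_pi fun i => by
    refine Fin.cases ?_ (fun i => ?_) i
    · simp only [Fin.cons_zero]
      fun_prop
    · simp only [Fin.cons_succ]
      exact (continuous_apply i).comp continuous_subtype_val

theorem IsSmoothSimplex.continuous {d : ℕ} {T : Type*} [Fintype T] {τ : Simplex d → T → ℂ}
    (h : IsSmoothSimplex τ) : Continuous τ := by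
  obtain ⟨g, hg, e⟩ := h
  rw [show τ = fun x => g x.1 from funext fun x => (e x).symm]
  exact hg.continuous.comp continuous_subtype_val

theorem IsSmoothSimplex.contDiffOn_inCoords {d : ℕ} {T : Type*} [Fintype T]
    {τ : Simplex d → T → ℂ} (h : IsSmoothSimplex τ) :
    ContDiffOn ℝ (⊤ : ℕ∞) (inCoords τ) (corner d) := by
  obtain ⟨g, hg, e⟩ := h
  have h1 : ContDiff ℝ (⊤ : ℕ∞) fun y : Fin d → ℝ =>
      g (Fin.cons (1 - ∑ i, y i) y : Fin (d + 1) → ℝ) := by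
    refine hg.comp (contDiff_pi.2 fun i => ?_)
    refine Fin.cases ?_ (fun i => ?_) i
    · simp only [Fin.cons_zero]
      fun_prop
    · simp only [Fin.cons_succ]
      fun_prop
  exact h1.contDiffOn.congr fun y hy => by rw [inCoords_of_mem τ hy, ← e]

theorem IsBranchAlong.continuous {d : ℕ} {E ι : Type*} [Fintype ι] {g : ι → E → ℂ} {a : ι → ℂ}
    {κ : ℂ} {τ : Simplex d → E} {s : Simplex d → ℂ} (h : IsBranchAlong g a κ τ s) :
    Continuous s := by
  obtain ⟨L, hL, -, c, hs⟩ := h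
  rw [show s = fun x => c * Complex.exp (κ⁻¹ * ∑ f, a f * L f x) from funext hs]
  fun_prop

variable {r : ℕ} {m : Fin r → ℕ}

theorem IsSmoothSimplex.continuousOn_jacobian {τ : Simplex (∑ k, m k) → Coord m → ℂ}
    (h : IsSmoothSimplex τ) : ContinuousOn (jacobian τ) (corner _) := by
  have h1 := h.contDiffOn_inCoords.continuousOn_fderivWithin (uniqueDiffOn_corner _) (by simp)
  unfold jacobian
  refine (Continuous.matrix_det continuous_id).comp_continuousOn ?_
  refine continuousOn_pi.2 fun a => continuousOn_pi.2 fun b => ?_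
  have h2 : ContinuousOn (fun y => fderivWithin ℝ (inCoords τ) (corner _) y (Pi.single b 1))
      (corner _) := h1.clm_apply continuousOn_const
  exact (continuous_apply (finSigmaFinEquiv.symm a)).comp_continuousOn h2

end Corner

/-! ### Integrals over twisted cycles and symmetrization -/

section ChainIntegrals

variable {r q : ℕ} {m : Fin r → ℕ} {w : Fin q → ℂ} {ι : Type*} [Fintype ι]
  {g : ι → (Coord m → ℂ) → ℂ} {a : ι → ℂ} {κ : ℂ} (γ : TwistedCycle m w g a κ)

theorem TwistedCycle.integrableOn_pullback {f : (Coord m → ℂ) → ℂ}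
    (hf : ContinuousOn f (complementSet m w)) {τ} (hτ : τ ∈ γ.chain.support) :
    MeasureTheory.IntegrableOn (pullback τ (γ.chain τ) f) (corner _) := by
  refine ContinuousOn.integrableOn_compact (isCompact_corner _) ?_
  refine ((continuousOn_inCoords (γ.branch τ hτ).continuous).mul ?_).mul
    (γ.smooth τ hτ).continuousOn_jacobian
  refine hf.comp (continuousOn_inCoords (γ.smooth τ hτ).continuous) fun y hy => ?_
  rw [inCoords_of_mem τ hy]
  exact γ.mem_complement τ hτ _

theorem TwistedCycle.chainIntegral_congr {f f' : (Coord m → ℂ) → ℂ}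
    (h : ∀ t ∈ complementSet m w, f t = f' t) :
    chainIntegral γ.chain f = chainIntegral γ.chain f' := by
  refine Finset.sum_congr rfl fun τ hτ => ?_
  refine MeasureTheory.setIntegral_congr_fun (isClosed_corner _).measurableSet fun y hy => ?_
  simp only [pullback]
  rw [h]
  rw [inCoords_of_mem τ hy]
  exact γ.mem_complement τ hτ _

theorem TwistedCycle.chainIntegral_sum {α : Type*} (s : Finset α) {f : α → (Coord m → ℂ) → ℂ}
    (hf : ∀ i ∈ s, ContinuousOn (f i) (complementSet m w)) :
    chainIntegral γ.chain (fun t => ∑ i ∈ s, f i t) = ∑ i ∈ s, chainIntegral γ.chain (f i) := by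
  unfold chainIntegral Finsupp.sum
  rw [Finset.sum_comm]
  refine Finset.sum_congr rfl fun τ hτ => ?_
  rw [← MeasureTheory.integral_finsetSum _ fun i hi => γ.integrableOn_pullback (hf i hi) hτ]
  refine congrArg _ (funext fun y => ?_)
  simp only [pullback, Finset.mul_sum, Finset.sum_mul]

theorem chainIntegral_mul_const (c : Chain (∑ k, m k) (Coord m → ℂ)) (f : (Coord m → ℂ) → ℂ)
    (x : ℂ) : chainIntegral c (fun t => f t * x) = chainIntegral c f * x := by
  unfold chainIntegral Finsupp.sum
  rw [Finset.sum_mul]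
  refine Finset.sum_congr rfl fun τ _ => ?_
  rw [← MeasureTheory.integral_mul_const]
  refine congrArg _ (funext fun y => ?_)
  simp only [pullback]
  ring

theorem TwistedCycle.hasChainIntegral_sum_smul {W α : Type*} [AddCommGroup W] [Module ℂ W]
    (s : Finset α) {f : α → (Coord m → ℂ) → ℂ} (e : α → W)
    (hf : ∀ i ∈ s, ContinuousOn (f i) (complementSet m w)) :
    HasChainIntegral γ.chain (fun t => ∑ i ∈ s, f i t • e i)
      (∑ i ∈ s, chainIntegral γ.chain (f i) • e i) := by
  intro ξ
  have hc : ∀ i ∈ s, ContinuousOn (fun t => f i t * ξ (e i)) (complementSet m w) :=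
    fun i hi => (hf i hi).mul continuousOn_const
  simp only [map_sum, map_smul, smul_eq_mul]
  refine ⟨fun τ hτ => γ.integrableOn_pullback (continuousOn_finsetSum _ hc) hτ, ?_⟩
  rw [γ.chainIntegral_sum s hc]
  exact Finset.sum_congr rfl fun i _ => chainIntegral_mul_const _ _ _

theorem continuous_permute (σ : ∀ k, Equiv.Perm (Fin (m k))) : Continuous (permute σ) :=
  continuous_pi fun _ => continuous_apply _

theorem permute_mem_complementSet (σ : ∀ k, Equiv.Perm (Fin (m k))) {t : Coord m → ℂ}
    (ht : t ∈ complementSet m w) : permute σ t ∈ complementSet m w := by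
  refine ⟨fun a j => ht.1 _ j, fun a b hab => ht.2.1 _ _ hab, fun a b hab hne => ht.2.2 _ _ hab ?_⟩
  rintro e
  obtain ⟨k, d⟩ := a
  obtain ⟨k', d'⟩ := b
  obtain rfl : k = k' := hab
  have := (σ k).injective (eq_of_heq (Sigma.mk.inj e).2)
  exact hne (congrArg (Sigma.mk k) this)

theorem TwistedCycle.card_mul_chainIntegral (hγ : MatsuoAssumption w γ.chain)
    {f : (Coord m → ℂ) → ℂ} (hf : IsRationalWithPoles w f)
    (hc : ContinuousOn f (complementSet m w)) :
    (Fintype.card (∀ k, Equiv.Perm (Fin (m k))) : ℂ) * chainIntegral γ.chain f =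
      chainIntegral γ.chain fun t => ∑ σ, f (permute σ t) := by
  rw [γ.chainIntegral_sum Finset.univ (f := fun σ t => f (permute σ t))
    fun σ _ => hc.comp (continuous_permute σ).continuousOn
      fun t ht => permute_mem_complementSet σ ht]
  have h := Finset.sum_congr (rfl : (Finset.univ : Finset (∀ k, Equiv.Perm (Fin (m k)))) = _)
    fun σ _ => hγ f hf σ
  rw [Finset.sum_const, nsmul_eq_mul] at h
  exact h

/-- Linear functionals separate vectors over ℂ, which reduces to scalar integrands. There each
integral, multiplied by the nonzero order of Σ, is the integral of the symmetrization. -/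
theorem TwistedCycle.eq_of_sum_permute_eq {W : Type*} [AddCommGroup W] [Module ℂ W]
    (hγ : MatsuoAssumption w γ.chain) {F G : (Coord m → ℂ) → W} {x y : W}
    (hF : HasChainIntegral γ.chain F x) (hG : HasChainIntegral γ.chain G y)
    (rF : ∀ ξ : Module.Dual ℂ W, IsRationalWithPoles w fun t => ξ (F t))
    (rG : ∀ ξ : Module.Dual ℂ W, IsRationalWithPoles w fun t => ξ (G t))
    (cF : ∀ ξ : Module.Dual ℂ W, ContinuousOn (fun t => ξ (F t)) (complementSet m w))
    (cG : ∀ ξ : Module.Dual ℂ W, ContinuousOn (fun t => ξ (G t)) (complementSet m w))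
    (h : ∀ t ∈ complementSet m w, ∑ σ, F (permute σ t) = ∑ σ, G (permute σ t)) : x = y := by
  rw [← sub_eq_zero, ← Module.forall_dual_apply_eq_zero_iff ℂ]
  intro ξ
  rw [map_sub, sub_eq_zero, ← (hF ξ).2, ← (hG ξ).2]
  refine mul_left_cancel₀ (Nat.cast_ne_zero.2
    (Fintype.card_ne_zero (α := ∀ k, Equiv.Perm (Fin (m k))))) ?_
  rw [γ.card_mul_chainIntegral hγ (rF ξ) (cF ξ), γ.card_mul_chainIntegral hγ (rG ξ) (cG ξ)]
  refine γ.chainIntegral_congr fun t ht => ?_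
  rw [← map_sum, ← map_sum, h t ht]

end ChainIntegrals
-- Rational functions with poles on the given hyperplanes
section RationalFunctions

variable {r q : ℕ} {m : Fin r → ℕ} {w : Fin q → ℂ}

/-- The product of the equations of the hyperplanes `t_a = w_j` and `t_a = t_b`, for `a`, `b` of
consecutive colors. -/
noncomputable def polesPoly (m : Fin r → ℕ) (w : Fin q → ℂ) : MvPolynomial (Coord m) ℂ :=
  (∏ a, ∏ j, (MvPolynomial.X a - MvPolynomial.C (w j))) *
    ∏ a : Coord m, ∏ b : Coord m,
      if (a.1 : ℕ) + 1 = b.1 then MvPolynomial.X a - MvPolynomial.X b else 1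

theorem eval_polesPoly (t : Coord m → ℂ) : MvPolynomial.eval t (polesPoly m w) =
    (∏ a, ∏ j, (t a - w j)) *
      ∏ a : Coord m, ∏ b : Coord m, if (a.1 : ℕ) + 1 = b.1 then t a - t b else 1 := by
  simp only [polesPoly, map_mul, map_prod, map_sub, MvPolynomial.eval_X, MvPolynomial.eval_C,
    apply_ite (MvPolynomial.eval t), map_one]

theorem eval_polesPoly_ne_zero {t : Coord m → ℂ} (h₁ : ∀ a j, t a ≠ w j)
    (h₂ : ∀ a b : Coord m, (a.1 : ℕ) + 1 = b.1 → t a ≠ t b) :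
    MvPolynomial.eval t (polesPoly m w) ≠ 0 := by
  rw [eval_polesPoly]
  refine mul_ne_zero (Finset.prod_ne_zero_iff.2 fun a _ => Finset.prod_ne_zero_iff.2 fun j _ =>
    sub_ne_zero.2 (h₁ a j)) (Finset.prod_ne_zero_iff.2 fun a _ => Finset.prod_ne_zero_iff.2
      fun b _ => ?_)
  split_ifs with h
  · exact sub_ne_zero.2 (h₂ a b h)
  · exact one_ne_zero

theorem isRationalWithPoles_iff {f : (Coord m → ℂ) → ℂ} : IsRationalWithPoles w f ↔
    ∃ (P : MvPolynomial (Coord m) ℂ) (e : ℕ), ∀ t : Coord m → ℂ,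
      (∀ a j, t a ≠ w j) → (∀ a b : Coord m, (a.1 : ℕ) + 1 = b.1 → t a ≠ t b) →
        f t = MvPolynomial.eval t P / MvPolynomial.eval t (polesPoly m w) ^ e := by
  simp only [eval_polesPoly]
  rfl

theorem isRationalWithPoles_const (x : ℂ) :
    IsRationalWithPoles (m := m) w fun _ => x :=
  ⟨MvPolynomial.C x, 0, fun t _ _ => by simp⟩

theorem IsRationalWithPoles.mul {f f' : (Coord m → ℂ) → ℂ} (hf : IsRationalWithPoles w f)
    (hf' : IsRationalWithPoles w f') : IsRationalWithPoles w fun t => f t * f' t := by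
  obtain ⟨P, e, h⟩ := hf
  obtain ⟨P', e', h'⟩ := hf'
  refine ⟨P * P', e + e', fun t h₁ h₂ => ?_⟩
  beta_reduce
  rw [h t h₁ h₂, h' t h₁ h₂, map_mul, pow_add, mul_div_mul_comm]

theorem IsRationalWithPoles.add {f f' : (Coord m → ℂ) → ℂ} (hf : IsRationalWithPoles w f)
    (hf' : IsRationalWithPoles w f') : IsRationalWithPoles w fun t => f t + f' t := by
  rw [isRationalWithPoles_iff] at *
  obtain ⟨P, e, h⟩ := hf
  obtain ⟨P', e', h'⟩ := hf'
  refine ⟨P * polesPoly m w ^ e' + polesPoly m w ^ e * P', e + e', fun t h₁ h₂ => ?_⟩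
  have h₀ := eval_polesPoly_ne_zero h₁ h₂
  rw [h t h₁ h₂, h' t h₁ h₂, div_add_div _ _ (pow_ne_zero _ h₀) (pow_ne_zero _ h₀), pow_add]
  simp only [map_add, map_mul, map_pow]

theorem IsRationalWithPoles.sum {α : Type*} (s : Finset α) {f : α → (Coord m → ℂ) → ℂ}
    (hf : ∀ i ∈ s, IsRationalWithPoles w (f i)) :
    IsRationalWithPoles w fun t => ∑ i ∈ s, f i t := by
  classical
  induction s using Finset.induction_on with
  | empty => simpa using isRationalWithPoles_const 0
  | insert i s hi ih =>
    simp only [Finset.sum_insert hi]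
    exact (hf i (Finset.mem_insert_self i s)).add
      (ih fun j hj => hf j (Finset.mem_insert_of_mem hj))

theorem IsRationalWithPoles.prod {α : Type*} (s : Finset α) {f : α → (Coord m → ℂ) → ℂ}
    (hf : ∀ i ∈ s, IsRationalWithPoles w (f i)) :
    IsRationalWithPoles w fun t => ∏ i ∈ s, f i t := by
  classical
  induction s using Finset.induction_on with
  | empty => simpa using isRationalWithPoles_const 1
  | insert i s hi ih =>
    simp only [Finset.prod_insert hi]
    exact (hf i (Finset.mem_insert_self i s)).mul
      (ih fun j hj => hf j (Finset.mem_insert_of_mem hj))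

/-- The complementary divisor serves as numerator over the full pole polynomial. -/
theorem isRationalWithPoles_one_div_eval {Q : MvPolynomial (Coord m) ℂ}
    (hQ : Q ∣ polesPoly m w) : IsRationalWithPoles w fun t => 1 / MvPolynomial.eval t Q := by
  obtain ⟨P, hP⟩ := hQ
  rw [isRationalWithPoles_iff]
  refine ⟨P, 1, fun t h₁ h₂ => ?_⟩
  have h₀ := eval_polesPoly_ne_zero h₁ h₂
  rw [hP, map_mul] at h₀
  rw [hP, map_mul, pow_one, mul_comm, ← div_div, div_self (right_ne_zero_of_mul h₀)]

theorem isRationalWithPoles_one_div_sub_const (a : Coord m) (j : Fin q) :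
    IsRationalWithPoles w fun t => 1 / (t a - w j) := by
  have h := isRationalWithPoles_one_div_eval (m := m) (w := w)
    (Q := MvPolynomial.X a - MvPolynomial.C (w j))
    (Dvd.dvd.mul_right ((Finset.dvd_prod_of_mem _ (Finset.mem_univ j)).trans
      (Finset.dvd_prod_of_mem (fun a => ∏ j, (MvPolynomial.X a - MvPolynomial.C (w j)))
        (Finset.mem_univ a))) _)
  simpa using h

theorem isRationalWithPoles_one_div_sub {a b : Coord m} (hab : (a.1 : ℕ) + 1 = b.1) :
    IsRationalWithPoles w fun t => 1 / (t a - t b) := by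
  have h1 : (MvPolynomial.X a - MvPolynomial.X b : MvPolynomial (Coord m) ℂ) =
      if (a.1 : ℕ) + 1 = b.1 then MvPolynomial.X a - MvPolynomial.X b else 1 := (if_pos hab).symm
  have h := isRationalWithPoles_one_div_eval (m := m) (w := w)
    (Q := MvPolynomial.X a - MvPolynomial.X b) (by
      refine Dvd.dvd.mul_left ?_ _
      conv_lhs => rw [h1]
      exact (Finset.dvd_prod_of_mem (fun b : Coord m => if (a.1 : ℕ) + 1 = b.1 then
        MvPolynomial.X a - MvPolynomial.X b else 1) (Finset.mem_univ b)).trans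
        (Finset.dvd_prod_of_mem (fun a : Coord m => ∏ b : Coord m, if (a.1 : ℕ) + 1 = b.1 then
          MvPolynomial.X a - MvPolynomial.X b else 1) (Finset.mem_univ a)))
  simpa using h

theorem IsRationalWithPoles.continuousOn {f : (Coord m → ℂ) → ℂ} (hf : IsRationalWithPoles w f) :
    ContinuousOn f (complementSet m w) := by
  obtain ⟨P, e, h⟩ := isRationalWithPoles_iff.1 hf
  refine ContinuousOn.congr ?_ fun t ht => h t ht.1 ht.2.1
  exact (MvPolynomial.continuous_eval P).continuousOn.div
    ((MvPolynomial.continuous_eval _).pow e).continuousOn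
    fun t ht => pow_ne_zero _ (eval_polesPoly_ne_zero ht.1 ht.2.1)

/-- The bounds on c make every variable involved a genuine coordinate, not the default value 0 of
`colVar`. -/
theorem isRationalWithPoles_rootFun (j : Fin q) {c : ℕ} {a : PosRoot r}
    (hc : (a.1.1 : ℕ) ≤ c ∧ c < a.1.2) (d : ∀ h : RootCol a, Fin (m h.1)) :
    IsRationalWithPoles w fun t => rootFun t (w j) c a d := by
  have hr := a.1.2.isLt
  unfold rootFun
  refine (IsRationalWithPoles.prod _ fun h hh => ?_).mul ?_
  · rw [Finset.mem_Ico] at hh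
    simp only [colVar, dif_pos (show (a.1.1 : ℕ) ≤ h ∧ h < a.1.2 by omega),
      dif_pos (show (a.1.1 : ℕ) ≤ h + 1 ∧ h + 1 < a.1.2 by omega)]
    exact isRationalWithPoles_one_div_sub rfl
  · simp only [colVar, dif_pos hc]
    exact isRationalWithPoles_one_div_sub_const _ j

variable {p : ℕ} {z : Fin p → ℂ}

theorem isRationalWithPoles_phi (hzw : ∀ j, ∃ j', z j = w j') (β : Bijections m p)
    (I : indexSet m p) : IsRationalWithPoles w (phi β I z) := by
  refine IsRationalWithPoles.prod _ fun s _ => ?_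
  obtain ⟨j, hj⟩ := hzw s.1
  simp only [slotPhi_eq_rootFun, hj]
  have := s.2.1.2
  exact isRationalWithPoles_rootFun j (by omega) _

theorem isRationalWithPoles_phiAt (hzw : ∀ j, ∃ j', z j = w j') (β : Bijections m p)
    (I : indexSet m p) (h : Fin r) : IsRationalWithPoles w (phiAt β I h z) := by
  refine IsRationalWithPoles.prod _ fun s _ => ?_
  obtain ⟨j, hj⟩ := hzw s.1
  simp only [slotPhiAt_eq_rootFun, hj]
  have := s.2.1.2
  refine (isRationalWithPoles_const _).mul (isRationalWithPoles_rootFun j ?_ _)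
  unfold attachAt
  omega

end RationalFunctions

/-! ### Equality of the vector-valued integrals -/

section Integrals

variable {r p q : ℕ} {m : Fin r → ℕ} {w : Fin q → ℂ} {V : Fin p → Type*}
  [∀ j, AddCommGroup (V j)] [∀ j, Module ℂ (V j)] [∀ j, LieRingModule (SL r) (V j)]
  [∀ j, LieModule ℂ (SL r) (V j)] {z : Fin p → ℂ} {ι : Type*} [Fintype ι]
  {g : ι → (Coord m → ℂ) → ℂ} {a : ι → ℂ} {κ : ℂ} (γ : TwistedCycle m w g a κ)

theorem vectorIntegral_eq {W : Type*} [AddCommGroup W] [Module ℂ W]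
    {c : Chain (∑ k, m k) (Coord m → ℂ)} {f : (Coord m → ℂ) → W} {x : W}
    (h : HasChainIntegral c f x) : vectorIntegral c f = x := by
  have h' : ∃ x, HasChainIntegral c f x := ⟨x, h⟩
  unfold vectorIntegral
  rw [dif_pos h']
  exact h'.choose_spec.unique h

theorem isRationalWithPoles_dual_sum_smul {W α : Type*} [AddCommGroup W] [Module ℂ W]
    (s : Finset α) {f : α → (Coord m → ℂ) → ℂ} (e : α → W)
    (hf : ∀ i ∈ s, IsRationalWithPoles w (f i)) (ξ : Module.Dual ℂ W) :
    IsRationalWithPoles w fun t => ξ (∑ i ∈ s, f i t • e i) := by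
  simp only [map_sum, map_smul, smul_eq_mul]
  exact IsRationalWithPoles.sum _ fun i hi => (hf i hi).mul (isRationalWithPoles_const _)

theorem isRationalWithPoles_dual_stdForm (hzw : ∀ j, ∃ j', z j = w j') (v : ∀ j, V j)
    (β : Bijections m p) (ξ : Module.Dual ℂ (PiTensorProduct ℂ V)) :
    IsRationalWithPoles w fun t => ξ (stdForm v β z t) := by
  unfold stdForm
  exact isRationalWithPoles_dual_sum_smul _ _ (fun I _ => isRationalWithPoles_phi hzw β I) ξ

theorem isRationalWithPoles_dual_specialForm (hzw : ∀ j, ∃ j', z j = w j') (v : ∀ j, V j)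
    (β : Bijections m p) (h : Fin r) (ξ : Module.Dual ℂ (PiTensorProduct ℂ V)) :
    IsRationalWithPoles w fun t => ξ (specialForm v β h z t) := by
  unfold specialForm
  exact isRationalWithPoles_dual_sum_smul _ _ (fun I _ => isRationalWithPoles_phiAt hzw β I h) ξ

theorem TwistedCycle.hasChainIntegral_stdForm (hzw : ∀ j, ∃ j', z j = w j') (v : ∀ j, V j)
    (β : Bijections m p) :
    HasChainIntegral γ.chain (stdForm v β z) (vectorIntegral γ.chain (stdForm v β z)) := by
  have h := γ.hasChainIntegral_sum_smul Finset.univ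
    (fun I : indexSet m p => PiTensorProduct.tprod ℂ fun j => act (stdF (I.1 j)) (v j))
    fun I _ => (isRationalWithPoles_phi hzw β I).continuousOn
  change HasChainIntegral γ.chain (stdForm v β z) _ at h
  rwa [← vectorIntegral_eq h] at h

theorem TwistedCycle.hasChainIntegral_specialForm (hzw : ∀ j, ∃ j', z j = w j') (v : ∀ j, V j)
    (β : Bijections m p) (h : Fin r) :
    HasChainIntegral γ.chain (specialForm v β h z)
      (vectorIntegral γ.chain (specialForm v β h z)) := by
  have h' := γ.hasChainIntegral_sum_smul Finset.univ
    (fun I : indexSet m p => PiTensorProduct.tprod ℂ fun j => act (specialF h (I.1 j)) (v j))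
    fun I _ => (isRationalWithPoles_phiAt hzw β I h).continuousOn
  change HasChainIntegral γ.chain (specialForm v β h z) _ at h'
  rwa [← vectorIntegral_eq h'] at h'

/-- Only the inclusion of the points z_j among the w_j matters, so the rational case (w = z) and the
trigonometric case (w = z with 0 added) are treated together. -/
theorem TwistedCycle.integral_stdForm_eq_integral_specialForm (hzw : ∀ j, ∃ j', z j = w j')
    (hγ : MatsuoAssumption w γ.chain) (v : ∀ j, V j) (β : Bijections m p) (h : Fin r) :
    vectorIntegral γ.chain (stdForm v β z) = vectorIntegral γ.chain (specialForm v β h z) := by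
  have rF := isRationalWithPoles_dual_stdForm (m := m) hzw v β
  have rG := isRationalWithPoles_dual_specialForm hzw v β h
  refine γ.eq_of_sum_permute_eq hγ (γ.hasChainIntegral_stdForm hzw v β)
    (γ.hasChainIntegral_specialForm hzw v β h) rF rG (fun ξ => (rF ξ).continuousOn)
    (fun ξ => (rG ξ).continuousOn) fun t ht => ?_
  refine sum_stdForm_permute v β h (fun x j => ?_) ht.2.1
  obtain ⟨j', hj'⟩ := hzw j
  rw [hj']
  exact ht.1 x j'

theorem TwistedCycle.hasChainIntegral_forms (hzw : ∀ j, ∃ j', z j = w j')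
    (hγ : MatsuoAssumption w γ.chain) (v : ∀ j, V j) (β : Bijections m p) (h : Fin r) :
    HasChainIntegral γ.chain (stdForm v β z) (vectorIntegral γ.chain (stdForm v β z)) ∧
      HasChainIntegral γ.chain (specialForm v β h z) (vectorIntegral γ.chain (stdForm v β z)) ∧
      vectorIntegral γ.chain (stdForm v β z) = vectorIntegral γ.chain (specialForm v β h z) := by
  have e := γ.integral_stdForm_eq_integral_specialForm hzw hγ v β h
  refine ⟨γ.hasChainIntegral_stdForm hzw v β, ?_, e⟩
  rw [e]
  exact γ.hasChainIntegral_specialForm hzw v β h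

end Integrals
end KZ

theorem mainTheorem6 {r p : ℕ} {V : Fin p → Type*} [∀ j, AddCommGroup (V j)]
    [∀ j, Module ℂ (V j)] [∀ j, LieRingModule (SL r) (V j)] [∀ j, LieModule ℂ (SL r) (V j)]
    (Λ : Fin p → Cartan r) (v : ∀ j, V j) (hv : ∀ j, IsHighestWeight (Λ j) (v j))
    (m : Fin r → ℕ) (κ : ℂ) (hκ : κ ≠ 0) (β : Bijections m p) :
    (∀ (U : Set (Fin p → ℂ)) (_ : ∀ z ∈ U, Function.Injective z)
      (γ : ∀ z : U, RatCycle m Λ κ z.1)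
      (_ : ∀ z : U, MatsuoAssumption z.1 (γ z).chain) (h : Fin r) (z : U),
      HasChainIntegral (γ z).chain (stdForm v β z.1) (ratSolution v β γ z) ∧
      HasChainIntegral (γ z).chain (specialForm v β h z.1) (ratSolution v β γ z) ∧
      ratSolution v β γ z = ratSolutionAt v β γ h z) ∧
    (∀ (lam : Cartan r) (U : Set (Fin p → ℂ))
      (_ : ∀ z ∈ U, Function.Injective z ∧ ∀ i, z i ≠ 0)
      (γ : ∀ z : U, TrigCycle m Λ κ lam z.1)
      (_ : ∀ z : U, MatsuoAssumption (Fin.snoc z.1 0 : Fin (p + 1) → ℂ) (γ z).chain)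
      (h : Fin r) (z : U),
      HasChainIntegral (γ z).chain (stdForm v β z.1) (trigSolution v β γ z) ∧
      HasChainIntegral (γ z).chain (specialForm v β h z.1) (trigSolution v β γ z) ∧
      trigSolution v β γ z = trigSolutionAt v β γ h z) := by

  refine ⟨fun U _ γ hγ h z => ?_, fun lam U _ γ hγ h z => ?_⟩
  · exact (γ z).hasChainIntegral_forms (fun j => ⟨j, rfl⟩) (hγ z) v β h
  -- The extra point 0 is appended last, so z_j keeps its index in the longer tuple.
  · exact (γ z).hasChainIntegral_forms
      (fun j => ⟨j.castSucc, (Fin.snoc_castSucc (α := fun _ => ℂ) 0 z.1 j).symm⟩) (hγ z) v β h
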